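/- Let $\mathcal G_1,\mathcal G_2$ be finite connected undirected graphs on disjoint vertex sets $V_1,V_2$ with $N_1,N_2$ vertices, $N=N_1+N_2$, with positive edge weights $w$ (and no loops) such that $\sum_{v}w(r,v)<1$ for every vertex $r$, the sum being over the neighbours of $r$ in its own graph. Let $\mathbf L_1,\mathbf L_2$ be their weighted Laplacian matrices, $\mathbf L_k^{\dagger}$ the Moore–Penrose inverses, $\mathbf L_{sub}=\mathrm{diag}(\mathbf L_1,\mathbf L_2)$ and $\mathbf A=\mathbf I-\mathbf L_{sub}$. Join the two graphs by one edge of weight $1$ between bridge nodes $s_1\in V_1$ and $s_2\in V_2$. For $\beta\in\mathbb R$ put $\mathbf B=\beta\,\mathbf b\mathbf b^{T}$, where $\mathbf b$ is $1$ at $s_1$, $-1$ at $s_2$ and $0$ elsewhere, and let $\mathbf P=\mathbf I-\frac1N\mathbf 1\mathbf 1^{T}$. When the connecting edge is active at each time step with probability $p$, the mean square convergence rate of the consensus system is the spectral radius $\rho(\mathcal A_p)$ of the operator on $N\times N$ matrices $$\mathcal A_p(X)=\mathbf P(\mathbf A-p\mathbf B)\mathbf P\,X\,\mathbf P(\mathbf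 A-p\mathbf B)\mathbf P+p(1-p)\,\mathbf B X\mathbf B .$$ Let $\theta^{(1)}=\sqrt{\frac{N_2}{N N_1}}$ and $\theta^{(2)}=-\sqrt{\frac{N_1}{N N_2}}$. Then $\rho(\mathcal A_p)=\rho(\mathcal A_0)+C^{(1)}p+C_{22}^{(2)}p^2+o(p^2)$ as $p\to0^+$ for some (necessarily unique) real numbers $C^{(1)}$ and $C_{22}^{(2)}$, and the second-order coefficient satisfies $$C_{22}^{(2)}\ \ge\ 2\bigl(1-\beta(\theta^{(1)}-\theta^{(2)})^2\bigr)^2\beta^2\bigl(\mathbf L_1^{\dagger}(s_1,s_1)+\mathbf L_2^{\dagger}(s_2,s_2)\bigr)(\theta^{(1)}-\theta^{(2)})^2 .$$ If moreover all eigenvalues of $\mathbf L_1$ and $\mathbf L_2$ are at most $1$, then $$\begin{aligned}C_{22}^{(2)}\ \le\ &2\bigl(1-\beta(\theta^{(1)}-\theta^{(2)})^2\bigr)^2\beta^2\bigl(\mathbf L_1^{\dagger}(s_1,s_1)+\mathbf L_2^{\dagger}(s_2,s_2)\bigr)(\theta^{(1)}-\theta^{(2)})^2\\&+\beta^4\bigl(\mathbf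 L_1^{\dagger}(s_1,s_1)+\mathbf L_2^{\dagger}(s_2,s_2)\bigr)\Bigl(2-\frac1{N_1}-\frac1{N_2}\Bigr)(\theta^{(1)}-\theta^{(2)})^4 .\end{aligned}$$ For $k=1,2$, if $s_k$ has maximum information centrality in $\mathcal G_k$, then $\mathbf L_k^{\dagger}(s_k,s_k)\le\mathbf L_k^{\dagger}(t,t)$ for all $t\in V_k$; and if both $s_1$ and $s_2$ have maximum information centrality in their graphs, then both bounds above (as functions of the bridge nodes, with $\beta$ and the two graphs fixed) are minimized at $(s_1,s_2)$. Here the information centrality of a node $i$ of a graph with $n$ nodes and weighted Laplacian $\mathbf L$ is the Stephenson–Zelen centrality $n\big/\sum_{j}(c_{ii}+c_{jj}-2c_{ij})$, where $(c_{ij})=(\mathbf L+\mathbf 1\mathbf 1^{T})^{-1}$. -/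

import Mathlib

open scoped Topology
open Filter Asymptotics

noncomputable section

namespace NetworkOfNetworks

/-- A weighted undirected graph without loops on the vertex set `V`; the edges are the pairs of
vertices of positive weight, and `weight r s = 0` when `r` and `s` are not joined by an edge. -/
structure WeightedGraph (V : Type*) where
  weight : V → V → ℝ
  weight_symm : ∀ r s, weight r s = weight s r
  weight_nonneg : ∀ r s, 0 ≤ weight r s
  weight_self : ∀ r, weight r r = 0

namespace WeightedGraph

variable {V : Type*}

/-- The underlying simple graph. -/
def toSimpleGraph (G : WeightedGraph V) : SimpleGraph V where
  Adj r s := 0 < G.weight r s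
  symm := ⟨fun r s h => by rw [G.weight_symm s r]; exact h⟩
  loopless := ⟨fun r h => by rw [G.weight_self r] at h; exact lt_irrefl _ h⟩

variable [Fintype V] [DecidableEq V]

/-- The total weight of the edges at `r`. -/
def strength (G : WeightedGraph V) (r : V) : ℝ := ∑ k, G.weight r k

/-- The weighted Laplacian matrix. -/
def laplacian (G : WeightedGraph V) : Matrix V V ℝ :=
  Matrix.of fun r s => if r = s then G.strength r else -G.weight r s

theorem laplacian_isHermitian (G : WeightedGraph V) : G.laplacian.IsHermitian := by
  ext r s
  by_cases h : r = s
  · subst h; simp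
  · simp [laplacian, Matrix.of_apply, h, Ne.symm h, G.weight_symm r s]

/-- Information centrality (Stephenson and Zelen): with `C = (L + J)⁻¹`, where `J` is the all-ones
matrix, the information between `i` and `j` is `(C i i + C j j - 2 * C i j)⁻¹`, and the information
centrality of `i` is the harmonic mean over `j` of these numbers (the term of `j = i` being `∞`,
with inverse `0`). -/
def informationCentrality (G : WeightedGraph V) (i : V) : ℝ :=
  let C : Matrix V V ℝ := (G.laplacian + Matrix.of fun _ _ => 1)⁻¹
  (Fintype.card V : ℝ) / ∑ j, (C i i + C j j - 2 * C i j)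

end WeightedGraph

section MoorePenrose

variable {V : Type*} [Fintype V]

/-- The four Penrose conditions for real matrices. -/
structure IsMoorePenroseInverse (A X : Matrix V V ℝ) : Prop where
  mul_mul_left : A * X * A = A
  mul_mul_right : X * A * X = X
  symm_left : (A * X).transpose = A * X
  symm_right : (X * A).transpose = X * A

theorem IsMoorePenroseInverse.unique {A X Y : Matrix V V ℝ}
    (hX : IsMoorePenroseInverse A X) (hY : IsMoorePenroseInverse A Y) : X = Y := by
  have e1 : A * X = A * Y := by
    calc A * X = (A * Y * A) * X := by rw [hY.mul_mul_left]
      _ = (A * Y) * (A * X) := by simp only [Matrix.mul_assoc]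
      _ = (A * Y).transpose * (A * X).transpose := by rw [hX.symm_left, hY.symm_left]
      _ = ((A * X * A) * Y).transpose := by
          rw [← Matrix.transpose_mul]; simp only [Matrix.mul_assoc]
      _ = A * Y := by rw [hX.mul_mul_left, hY.symm_left]
  have e2 : X * A = Y * A := by
    calc X * A = X * (A * Y * A) := by rw [hY.mul_mul_left]
      _ = (X * A) * (Y * A) := by simp only [Matrix.mul_assoc]
      _ = (X * A).transpose * (Y * A).transpose := by rw [hX.symm_right, hY.symm_right]
      _ = (Y * (A * X * A)).transpose := by
          rw [← Matrix.transpose_mul]; simp only [Matrix.mul_assoc]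
      _ = Y * A := by rw [hX.mul_mul_left, hY.symm_right]
  calc X = X * A * X := hX.mul_mul_right.symm
    _ = Y * (A * X) := by rw [e2, Matrix.mul_assoc]
    _ = Y := by rw [e1, ← Matrix.mul_assoc, hY.mul_mul_right]

theorem exists_isMoorePenroseInverse [DecidableEq V] {A : Matrix V V ℝ} (hA : A.IsHermitian) :
    ∃ X, IsMoorePenroseInverse A X := by
  obtain ⟨U, d, hU, hA'⟩ : ∃ (U : Matrix V V ℝ) (d : V → ℝ),
      U.transpose * U = 1 ∧ A = U * Matrix.diagonal d * U.transpose := by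
    refine ⟨(hA.eigenvectorUnitary : Matrix V V ℝ), hA.eigenvalues, ?_, ?_⟩
    · have := Unitary.coe_star_mul_self hA.eigenvectorUnitary
      simpa [Matrix.star_eq_conjTranspose, Matrix.conjTranspose_eq_transpose_of_trivial] using this
    · have := hA.spectral_theorem
      rw [Unitary.conjStarAlgAut_apply] at this
      simpa [Matrix.star_eq_conjTranspose, Matrix.conjTranspose_eq_transpose_of_trivial,
        Function.comp_def] using this
  have key : ∀ D E : Matrix V V ℝ,
      (U * D * U.transpose) * (U * E * U.transpose) = U * (D * E) * U.transpose := by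
    intro D E
    calc _ = U * D * (U.transpose * U) * E * U.transpose := by simp only [Matrix.mul_assoc]
      _ = _ := by rw [hU]; simp only [Matrix.mul_assoc, Matrix.one_mul]
  refine ⟨U * Matrix.diagonal (fun i => (d i)⁻¹) * U.transpose, ?_, ?_, ?_, ?_⟩
  · rw [hA', key, key]
    simp [Matrix.diagonal_mul_diagonal]
  · rw [hA', key, key, Matrix.diagonal_mul_diagonal, Matrix.diagonal_mul_diagonal]
    have hd : (fun i => (d i)⁻¹ * d i * (d i)⁻¹) = fun i => (d i)⁻¹ := by
      funext i
      by_cases h : d i = 0 <;> simp [h]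
    rw [hd]
  · rw [hA', key]
    simp [Matrix.diagonal_mul_diagonal, Matrix.transpose_mul, Matrix.mul_assoc]
  · rw [hA', key]
    simp [Matrix.diagonal_mul_diagonal, Matrix.transpose_mul, Matrix.mul_assoc]

open Classical in
/-- The Moore-Penrose inverse of a real square matrix. -/
def mpInverse (A : Matrix V V ℝ) : Matrix V V ℝ :=
  if h : ∃ X, IsMoorePenroseInverse A X then h.choose else 0

theorem mpInverse_spec [DecidableEq V] {A : Matrix V V ℝ} (hA : A.IsHermitian) :
    IsMoorePenroseInverse A (mpInverse A) := by
  rw [mpInverse, dif_pos (exists_isMoorePenroseInverse hA)]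
  exact (exists_isMoorePenroseInverse hA).choose_spec

end MoorePenrose

section Operator

variable {V : Type*} [Fintype V] [DecidableEq V]

/-- The projection `I - (1/N) 1 1ᵀ` onto the vectors with zero average. -/
def projection (V : Type*) [Fintype V] [DecidableEq V] : Matrix V V ℝ :=
  1 - (1 / (Fintype.card V : ℝ)) • Matrix.of fun _ _ => (1 : ℝ)

/-- For real matrices `K` and `B`, the operator `X ↦ K X K + σ² B X B` on complex matrices. -/
def secondMomentOperator (K B : Matrix V V ℝ) (sigmaSq : ℝ) :
    Module.End ℂ (Matrix V V ℂ) where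
  toFun X := K.map Complex.ofReal * X * K.map Complex.ofReal +
    (sigmaSq : ℂ) • (B.map Complex.ofReal * X * B.map Complex.ofReal)
  map_add' X Y := by
    simp only [Matrix.mul_add, Matrix.add_mul, smul_add]; abel
  map_smul' c X := by
    simp only [Matrix.mul_smul, Matrix.smul_mul, smul_add, RingHom.id_apply, smul_comm c]

end Operator

/-- `f p = f 0 + c₁ p + c p² + o(p²)` as `p → 0⁺` for some `c₁`; this determines `c`. -/
def IsSecondOrderCoefficient (f : ℝ → ℝ) (c : ℝ) : Prop :=
  ∃ c₁ : ℝ, (fun p : ℝ => f p - (f 0 + c₁ * p + c * p ^ 2)) =o[𝓝[>] 0] fun p : ℝ => p ^ 2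

section TwoSubgraphs

variable {V₁ V₂ : Type*} [Fintype V₁] [Fintype V₂] [DecidableEq V₁] [DecidableEq V₂]

/-- The block diagonal Laplacian of the disjoint union of the two subgraphs. -/
def subLaplacian (G₁ : WeightedGraph V₁) (G₂ : WeightedGraph V₂) :
    Matrix (V₁ ⊕ V₂) (V₁ ⊕ V₂) ℝ :=
  Matrix.fromBlocks G₁.laplacian 0 0 G₂.laplacian

/-- The matrix `B = β b bᵀ` of the connecting edge (of weight one) between `s₁` and `s₂`, with
`b` equal to `1` at `s₁`, to `-1` at `s₂` and to `0` elsewhere. -/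
def edgeMatrix (β : ℝ) (s₁ : V₁) (s₂ : V₂) : Matrix (V₁ ⊕ V₂) (V₁ ⊕ V₂) ℝ :=
  let b : V₁ ⊕ V₂ → ℝ := Sum.elim (Pi.single s₁ 1) (-Pi.single s₂ 1)
  β • Matrix.vecMulVec b b

/-- The expected weight matrix `A - p B`, where `A = I - L_sub`. -/
def expectedWeightMatrix (G₁ : WeightedGraph V₁) (G₂ : WeightedGraph V₂) (β : ℝ)
    (s₁ : V₁) (s₂ : V₂) (p : ℝ) : Matrix (V₁ ⊕ V₂) (V₁ ⊕ V₂) ℝ :=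
  (1 - subLaplacian G₁ G₂) - p • edgeMatrix β s₁ s₂

/-- The operator `X ↦ (P (A - p B) P) X (P (A - p B) P) + σ² B X B`, which maps the second moment
matrix of the deviation from average at one time to that at the next, when the connecting edge is
active with probability `p`; `σ² = p (1 - p)` is the variance of a Bernoulli variable. -/
def meanSquareOperator (G₁ : WeightedGraph V₁) (G₂ : WeightedGraph V₂) (β : ℝ)
    (s₁ : V₁) (s₂ : V₂) (p : ℝ) :
    Module.End ℂ (Matrix (V₁ ⊕ V₂) (V₁ ⊕ V₂) ℂ) :=
  secondMomentOperator
    (projection (V₁ ⊕ V₂) * expectedWeightMatrix G₁ G₂ β s₁ s₂ p * projection (V₁ ⊕ V₂))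
    (edgeMatrix β s₁ s₂) (p * (1 - p))

/-- The mean square convergence rate: the spectral radius of the mean square operator. -/
def meanSquareRate (G₁ : WeightedGraph V₁) (G₂ : WeightedGraph V₂) (β : ℝ)
    (s₁ : V₁) (s₂ : V₂) (p : ℝ) : ℝ :=
  (spectralRadius ℂ (meanSquareOperator G₁ G₂ β s₁ s₂ p)).toReal

/-- `θ⁽¹⁾ - θ⁽²⁾` with `θ⁽¹⁾ = √(N₂ / (N N₁))`, `θ⁽²⁾ = -√(N₁ / (N N₂))` and `N = N₁ + N₂`. -/
def thetaDiff (N₁ N₂ : ℕ) : ℝ :=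
  let θ₁ : ℝ := √((N₂ : ℝ) / (((N₁ : ℝ) + N₂) * N₁))
  let θ₂ : ℝ := -√((N₁ : ℝ) / (((N₁ : ℝ) + N₂) * N₂))
  θ₁ - θ₂

/-- `L₁†(s₁, s₁) + L₂†(s₂, s₂)`. -/
def bridgeSum (G₁ : WeightedGraph V₁) (G₂ : WeightedGraph V₂) (s₁ : V₁) (s₂ : V₂) : ℝ :=
  mpInverse G₁.laplacian s₁ s₁ + mpInverse G₂.laplacian s₂ s₂

/-- The lower bound for the second-order coefficient. -/
def lowerBound (G₁ : WeightedGraph V₁) (G₂ : WeightedGraph V₂) (β : ℝ)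
    (s₁ : V₁) (s₂ : V₂) : ℝ :=
  let θ := thetaDiff (Fintype.card V₁) (Fintype.card V₂)
  2 * (1 - β * θ ^ 2) ^ 2 * β ^ 2 * bridgeSum G₁ G₂ s₁ s₂ * θ ^ 2

/-- The upper bound for the second-order coefficient. -/
def upperBound (G₁ : WeightedGraph V₁) (G₂ : WeightedGraph V₂) (β : ℝ)
    (s₁ : V₁) (s₂ : V₂) : ℝ :=
  let θ := thetaDiff (Fintype.card V₁) (Fintype.card V₂)
  2 * (1 - β * θ ^ 2) ^ 2 * β ^ 2 * bridgeSum G₁ G₂ s₁ s₂ * θ ^ 2 +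
    β ^ 4 * bridgeSum G₁ G₂ s₁ s₂ *
      (2 - 1 / (Fintype.card V₁ : ℝ) - 1 / (Fintype.card V₂ : ℝ)) * θ ^ 4

end TwoSubgraphs

end NetworkOfNetworks

end

/-! Put `K = P (I - L_sub) P` and `B = β b bᵀ`. The variance `p (1 - p)` exactly cancels the `p ^ 2`
term of `(K - p B) X (K - p B)`, so the mean square operator is affine in `p`: it is `T + p M` with
`T X = K X K` and `M X = B X B - B X K - K X B`, both symmetric for the Frobenius inner product.

Connectedness and strengths below `1` make `1` a simple eigenvalue of `K`, with unit eigenvector `u`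
constant on each subgraph, and make `K` shrink every vector that is not a multiple of `u`. Hence `w
= u uᵀ` is fixed by `T`, and `T` contracts strictly on its complement. Second-order perturbation
theory (`spectralRadius_sub_quadratic_isBigO`) gives the coefficient `⟨w, M y⟩`, where `y - T y = M
w - m₁ w` and `y ⟂ w`.

Write `b = θ u + c` with `c ⟂ u`, where `θ` is the difference of the two values of `u`. The vector
`d` made of `L₁† e_{s₁}` and `-L₂† e_{s₂}` solves `d - K d = c`, and `c ⬝ᵥ d` is the bridge sum. If
`Y - K Y K = c cᵀ`, the coefficient equals `2 α² (c ⬝ᵥ d) + γ² (cᵀ Y c)` with `α = β² θ³ - β θ` and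
`γ = β² θ²`. The first term is the lower bound, and `cᵀ Y c ≥ 0` because `T` is a contraction
(`stein_solution_nonneg`). Eigenvalues of the Laplacians at most `1` make `K` positive semidefinite,
and then `cᵀ Y c ≤ (c ⬝ᵥ d) (c ⬝ᵥ c)` (`stein_solution_le`), which is the upper bound.

For the centrality statements, `(L + J)⁻¹ = L† + J / n²`, so the centrality of `i` is `n / (n
L†(i,i) + tr L†)`; maximal centrality means minimal `L†(i,i)`, and both bounds increase with the
bridge sum. -/

noncomputable section

namespace NetworkOfNetworks

/-! ### Second-order perturbation of the spectral radius of a symmetric operator. -/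

section Perturbation

variable {E : Type*} [NormedAddCommGroup E] [InnerProductSpace ℂ E] [FiniteDimensional ℂ E]

/-- For a symmetric operator in finite dimension the spectral radius is the operator norm, and it is
attained at an eigenvalue. -/
theorem spectralRadius_of_isSymmetric [Nontrivial E] {A : Module.End ℂ E}
    (hA : LinearMap.IsSymmetric A) :
    (∀ x, ‖A x‖ ≤ (spectralRadius ℂ A).toReal * ‖x‖) ∧
      ∃ μ : ℝ, Module.End.HasEigenvalue A (μ : ℂ) ∧ |μ| = (spectralRadius ℂ A).toReal := by
  have : CompleteSpace E := FiniteDimensional.complete ℂ E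
  have hspec : spectrum ℂ (Module.End.toContinuousLinearMap E A) = spectrum ℂ A :=
    AlgEquiv.spectrum_eq (Module.End.toContinuousLinearMap E) A
  have hrad : spectralRadius ℂ A = spectralRadius ℂ (Module.End.toContinuousLinearMap E A) := by
    unfold spectralRadius
    rw [hspec]
  have hsa : IsSelfAdjoint (Module.End.toContinuousLinearMap E A) :=
    ContinuousLinearMap.isSelfAdjoint_iff_isSymmetric.mpr hA
  constructor
  · intro x
    rw [hrad, IsSelfAdjoint.spectralRadius_eq_nnnorm hsa]
    exact (Module.End.toContinuousLinearMap E A).le_opNorm x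
  · obtain ⟨μ, hμ, hμr⟩ := spectrum.exists_nnnorm_eq_spectralRadius
      (Module.End.toContinuousLinearMap E A)
    rw [hspec] at hμ
    have he := Module.End.hasEigenvalue_iff_mem_spectrum.mpr hμ
    have hconj := hA.conj_eigenvalue_eq_self he
    have hre : ((μ.re : ℝ) : ℂ) = μ := Complex.conj_eq_iff_re.mp hconj
    refine ⟨μ.re, by rwa [hre], ?_⟩
    rw [hrad, ← hμr, ← Real.norm_eq_abs, ← Complex.norm_real, hre]
    simp

/-- An operator that strictly decreases the norm of the vectors orthogonal to `w` is a strict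
contraction on the orthogonal complement of `w`. -/
theorem exists_contraction_constant {T : Module.End ℂ E} {w : E}
    (hcon : ∀ x, inner ℂ w x = 0 → x ≠ 0 → ‖T x‖ < ‖x‖) :
    ∃ r : ℝ, 0 ≤ r ∧ r < 1 ∧ ∀ x, inner ℂ w x = 0 → ‖T x‖ ≤ r * ‖x‖ := by
  have : ProperSpace E := FiniteDimensional.proper ℂ E
  have hTc : Continuous T := T.continuous_of_finiteDimensional
  -- Compactness of this slice of the unit sphere makes the contraction uniform; the slice is empty
  -- when `w` has trivial complement.
  set S : Set E := {x | inner ℂ w x = 0} ∩ Metric.sphere 0 1 with hS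
  have hcl : IsClosed {x : E | inner ℂ w x = 0} :=
    isClosed_eq (by fun_prop) continuous_const
  have hcomp : IsCompact S := (isCompact_sphere (0 : E) 1).inter_left hcl
  have hscale : ∀ r : ℝ, (∀ x ∈ S, ‖T x‖ ≤ r) → ∀ x, inner ℂ w x = 0 → ‖T x‖ ≤ r * ‖x‖ := by
    intro r hr x hx
    rcases eq_or_ne x 0 with rfl | hx0
    · simp
    have hn : 0 < ‖x‖ := norm_pos_iff.mpr hx0
    have := hr (((‖x‖⁻¹ : ℝ) : ℂ) • x) ⟨by simp [hx], by
      simp [norm_smul, hn.ne']⟩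
    rw [map_smul, norm_smul] at this
    simp only [Complex.norm_real, norm_inv, norm_norm] at this
    rwa [inv_mul_le_iff₀ hn, mul_comm] at this
  rcases S.eq_empty_or_nonempty with hempty | hne
  · exact ⟨0, le_rfl, one_pos, hscale 0 (by simp [hempty])⟩
  · obtain ⟨x₀, hx₀, hmax⟩ := hcomp.exists_isMaxOn hne (f := fun x => ‖T x‖) (by fun_prop)
    have h1 : ‖x₀‖ = 1 := by simpa using hx₀.2
    refine ⟨‖T x₀‖, norm_nonneg _, ?_, hscale _ fun x hx => hmax hx⟩
    rw [← h1]
    exact hcon x₀ hx₀.1 (by rintro rfl; simp at h1)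

/-- Solvability of `z - T z = q` for `q` orthogonal to the fixed vector `w`. -/
theorem exists_resolvent_solution {T : Module.End ℂ E} (hT : LinearMap.IsSymmetric T) {w : E}
    (hTw : T w = w) (hw : ‖w‖ = 1)
    (hcon : ∀ x, inner ℂ w x = 0 → x ≠ 0 → ‖T x‖ < ‖x‖)
    {q : E} (hq : inner ℂ w q = 0) : ∃ z, inner ℂ w z = 0 ∧ z - T z = q := by
  have : CompleteSpace E := FiniteDimensional.complete ℂ E
  have hsym : LinearMap.IsSymmetric (LinearMap.id - T : E →ₗ[ℂ] E) :=
    LinearMap.IsSymmetric.id.sub hT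
  have hww : inner ℂ w w = (1 : ℂ) := by rw [inner_self_eq_norm_sq_to_K, hw]; simp
  have hker : ∀ x, x - T x = 0 → x = (inner ℂ w x : ℂ) • w := by
    intro x hx
    by_contra hne
    have h0 : x - (inner ℂ w x : ℂ) • w ≠ 0 := sub_ne_zero.mpr hne
    have := hcon _ (by rw [inner_sub_right, inner_smul_right, hww]; ring) h0
    rw [map_sub, map_smul, hTw, ← sub_eq_zero.mp hx] at this
    exact lt_irrefl _ this
  -- The range of a symmetric operator is the complement of its kernel, and this kernel lies in the
  -- span of `w`.
  have hmem : q ∈ LinearMap.range (LinearMap.id - T : E →ₗ[ℂ] E) := by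
    rw [← Submodule.orthogonal_orthogonal (LinearMap.range (LinearMap.id - T : E →ₗ[ℂ] E)),
      hsym.orthogonal_range, Submodule.mem_orthogonal]
    intro x hx
    rw [hker x (by simpa using hx), inner_smul_left, hq, mul_zero]
  obtain ⟨z, hz⟩ := hmem
  refine ⟨z - (inner ℂ w z : ℂ) • w, by rw [inner_sub_right, inner_smul_right, hww]; ring, ?_⟩
  rw [map_sub, map_smul, hTw, ← hz]
  simp

/-- Quadratic expansion of the spectral radius of `T + p M` at a simple leading eigenvalue `1`. -/
theorem spectralRadius_sub_quadratic_isBigO {T M : Module.End ℂ E}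
    (hT : LinearMap.IsSymmetric T) (hM : LinearMap.IsSymmetric M) {w y : E} {m₁ m₂ : ℝ}
    (hTw : T w = w) (hw : ‖w‖ = 1)
    (hcon : ∀ x, inner ℂ w x = 0 → x ≠ 0 → ‖T x‖ < ‖x‖)
    (hwy : inner ℂ w y = 0) (hy : y - T y = M w - (m₁ : ℂ) • w)
    (hm₂ : inner ℂ w (M y) = (m₂ : ℂ)) :
    ∃ C ε : ℝ, 0 < ε ∧ ∀ p : ℝ, |p| < ε →
      |(spectralRadius ℂ (T + (p : ℂ) • M)).toReal - (1 + m₁ * p + m₂ * p ^ 2)| ≤ C * |p| ^ 3 := by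
  have : Nontrivial E := ⟨⟨w, 0, by rintro rfl; simp at hw⟩⟩
  have hww : inner ℂ w w = (1 : ℂ) := by rw [inner_self_eq_norm_sq_to_K, hw]; simp
  obtain ⟨r, hr0, hr1, hr⟩ := exists_contraction_constant hcon
  obtain ⟨z, hwz, hz⟩ := exists_resolvent_solution hT hTw hw hcon
    (q := M y - (m₁ : ℂ) • y - (m₂ : ℂ) • w) (by
      rw [inner_sub_right, inner_sub_right, inner_smul_right, inner_smul_right, hwy, hww, hm₂]
      ring)
  obtain ⟨c, hc0, hc⟩ : ∃ c : ℝ, 0 ≤ c ∧ ∀ x, ‖M x‖ ≤ c * ‖x‖ :=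
    ⟨‖LinearMap.toContinuousLinearMap M‖, norm_nonneg _,
      fun x => (LinearMap.toContinuousLinearMap M).le_opNorm x⟩
  -- Approximate eigenvector: `y` and `z` cancel the residual at orders `p` and `p ^ 2`, leaving `p
  -- ^ 3 R`. Both are orthogonal to `w`, so `⟨w, v p⟩ = 1`.
  set v : ℝ → E := fun p => w + (p : ℂ) • y + ((p : ℂ) ^ 2) • z with hv
  set lam : ℝ → ℝ := fun p => 1 + m₁ * p + m₂ * p ^ 2 with hlam
  set R : ℝ → E := fun p => M z - (m₁ : ℂ) • z - (m₂ : ℂ) • y - ((p : ℂ) * m₂) • z with hR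
  have hres : ∀ p : ℝ, (T + (p : ℂ) • M) (v p) = (lam p : ℂ) • v p + ((p : ℂ) ^ 3) • R p := by
    intro p
    have e1 : T y = y - (M w - (m₁ : ℂ) • w) := by rw [← hy]; abel
    have e2 : T z = z - (M y - (m₁ : ℂ) • y - (m₂ : ℂ) • w) := by rw [← hz]; abel
    simp only [hv, hlam, hR, LinearMap.add_apply, LinearMap.smul_apply, map_add, map_smul, hTw,
      e1, e2]
    push_cast
    module
  have hwv : ∀ p : ℝ, inner ℂ w (v p) = (1 : ℂ) := fun p => by
    simp only [hv, inner_add_right, inner_smul_right, hwy, hwz, hww]; ring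
  have hv1 : ∀ p : ℝ, 1 ≤ ‖v p‖ := fun p => by
    have := norm_inner_le_norm (𝕜 := ℂ) w (v p)
    rwa [hwv, hw, one_mul, norm_one] at this
  set D : ℝ := ‖y‖ + ‖z‖ with hD
  have hvw : ∀ p : ℝ, |p| ≤ 1 → ‖v p - w‖ ≤ |p| * D := fun p hp => by
    have e : v p - w = (p : ℂ) • y + ((p : ℂ) ^ 2) • z := by simp only [hv]; abel
    rw [e, hD, mul_add]
    refine (norm_add_le _ _).trans (add_le_add ?_ ?_)
    · simp [norm_smul]
    · rw [norm_smul, norm_pow, Complex.norm_real, Real.norm_eq_abs]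
      gcongr
      nlinarith [abs_nonneg p]
  set K : ℝ := ‖M z‖ + |m₁| * ‖z‖ + |m₂| * ‖y‖ + |m₂| * ‖z‖ with hK
  have hRK : ∀ p : ℝ, |p| ≤ 1 → ‖R p‖ ≤ K := fun p hp => by
    have e : ‖((p : ℂ) * m₂) • z‖ ≤ |m₂| * ‖z‖ := by
      rw [norm_smul, norm_mul, Complex.norm_real, Complex.norm_real, Real.norm_eq_abs,
        Real.norm_eq_abs]
      gcongr
      nlinarith [abs_nonneg m₂]
    refine (norm_sub_le _ _).trans (add_le_add ((norm_sub_le _ _).trans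
      (add_le_add ((norm_sub_le _ _).trans (add_le_add le_rfl ?_)) ?_)) e) <;>
    simp [norm_smul]
  have hK0 : 0 ≤ K := by positivity
  have hD0 : 0 ≤ D := by positivity
  -- Half the gap between the leading eigenvalue and the rest of the spectrum of `T`.
  set δ : ℝ := (1 - r) / 2 with hδ
  have hδ0 : 0 < δ := by rw [hδ]; linarith
  -- The spectral radius is an operator norm, so testing on `v p` bounds it from below.
  have hlow : ∀ p : ℝ, |p| ≤ 1 →
      lam p - |p| ^ 3 * K ≤ (spectralRadius ℂ (T + (p : ℂ) • M)).toReal := by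
    intro p hp
    have hA : LinearMap.IsSymmetric (T + (p : ℂ) • M) := hT.add (hM.smul (by simp))
    have h1 := (spectralRadius_of_isSymmetric hA).1 (v p)
    rw [hres] at h1
    have h2 : ‖(lam p : ℂ) • v p‖ - ‖((p : ℂ) ^ 3) • R p‖ ≤
        ‖(lam p : ℂ) • v p + ((p : ℂ) ^ 3) • R p‖ := by
      have := norm_sub_norm_le ((lam p : ℂ) • v p) (-(((p : ℂ) ^ 3) • R p))
      rwa [norm_neg, sub_neg_eq_add] at this
    rw [norm_smul, norm_smul, norm_pow, Complex.norm_real, Complex.norm_real, Real.norm_eq_abs,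
      Real.norm_eq_abs] at h2
    have h3 : |p| ^ 3 * ‖R p‖ ≤ |p| ^ 3 * K * ‖v p‖ := by
      have := hRK p hp
      calc |p| ^ 3 * ‖R p‖ ≤ |p| ^ 3 * K * 1 := by rw [mul_one]; gcongr
        _ ≤ _ := by gcongr; exact hv1 p
    have h4 : lam p * ‖v p‖ ≤ |lam p| * ‖v p‖ := by gcongr; exact le_abs_self _
    have h5 : 0 < ‖v p‖ := one_pos.trans_le (hv1 p)
    refine le_of_mul_le_mul_right ?_ h5
    rw [sub_mul]
    linarith
  obtain ⟨ε, hε0, hε⟩ : ∃ ε : ℝ, 0 < ε ∧ ∀ p : ℝ, |p| < ε →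
      |p| < 1 ∧ r + δ < lam p - |p| ^ 3 * K ∧ 0 < lam p ∧ |p| * (c / δ + D) < 1 / 2 := by
    have hc1 : Continuous fun p : ℝ => |p| := continuous_abs
    have hc2 : Continuous fun p : ℝ => lam p - |p| ^ 3 * K := by simp only [hlam]; fun_prop
    have hc3 : Continuous lam := by simp only [hlam]; fun_prop
    have hc4 : Continuous fun p : ℝ => |p| * (c / δ + D) := by fun_prop
    have hev := (hc1.continuousAt.eventually_lt (x₀ := 0) (continuousAt_const (y := (1 : ℝ)))
        (by simp)).and
      (((continuousAt_const (y := r + δ)).eventually_lt (x₀ := (0 : ℝ)) hc2.continuousAt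
        (by simp only [hlam, hδ]; norm_num; linarith)).and
      (((continuousAt_const (y := (0 : ℝ))).eventually_lt (x₀ := (0 : ℝ)) hc3.continuousAt
        (by simp [hlam])).and
      (hc4.continuousAt.eventually_lt (x₀ := 0) (continuousAt_const (y := (1 / 2 : ℝ)))
        (by simp))))
    obtain ⟨ε, h0, h⟩ := Metric.eventually_nhds_iff.mp hev
    exact ⟨ε, h0, fun p hp => h (by simpa using hp)⟩
  refine ⟨2 * K, ε, hε0, fun p hp => ?_⟩
  obtain ⟨hp1, hgap, hlam0, hsmall⟩ := hε p hp
  have hA : LinearMap.IsSymmetric (T + (p : ℂ) • M) := hT.add (hM.smul (by simp))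
  have hl := hlow p hp1.le
  -- For the upper bound, an exact eigenvector of an extremal eigenvalue is compared with `v p`; the
  -- sign of `μ` is not known in advance.
  obtain ⟨μ, hμ, hμρ⟩ := (spectralRadius_of_isSymmetric hA).2
  obtain ⟨x, hx⟩ := hμ.exists_hasEigenvector
  have hxe : (T + (p : ℂ) • M) x = (μ : ℂ) • x := hx.apply_eq_smul
  have hx0 : 0 < ‖x‖ := norm_pos_iff.mpr hx.2
  set a : ℂ := inner ℂ w x with ha
  set x' : E := x - a • w with hx'
  have hwx' : inner ℂ w x' = 0 := by rw [hx', inner_sub_right, inner_smul_right, hww, ← ha]; ring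
  have hx'w : inner ℂ x' w = 0 := by rw [← inner_conj_symm, hwx', map_zero]
  have hxdec : x = x' + a • w := by rw [hx']; abel
  -- Pairing the eigenvalue equation with `x'` removes the `w` component. Since `|μ| > r + δ` and
  -- `T` contracts by `r` there, `x'` is of size `O(p)`.
  have hx'bound : δ * ‖x'‖ ≤ |p| * c * ‖x‖ := by
    have e : (μ : ℂ) * inner ℂ x' x' = inner ℂ x' (T x') + p * inner ℂ x' (M x) := by
      have h1 : inner ℂ x' ((T + (p : ℂ) • M) x) = inner ℂ x' ((μ : ℂ) • x) := by rw [hxe]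
      have hTx : T x = T x' + a • w := by rw [hx', map_sub, map_smul, hTw]; abel
      have hxx : inner ℂ x' x = inner ℂ x' x' := by
        calc inner ℂ x' x = inner ℂ x' (x' + a • w) := by rw [← hxdec]
          _ = inner ℂ x' x' := by rw [inner_add_right, inner_smul_right, hx'w, mul_zero, add_zero]
      rw [LinearMap.add_apply, LinearMap.smul_apply, hTx, inner_add_right, inner_add_right,
        inner_smul_right, inner_smul_right, inner_smul_right, hx'w, hxx] at h1
      rw [← h1]; ring
    have h2 : |μ| * ‖x'‖ ^ 2 ≤ ‖x'‖ * (r * ‖x'‖) + |p| * (‖x'‖ * (c * ‖x‖)) := by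
      have h3 : ‖(μ : ℂ) * inner ℂ x' x'‖ = |μ| * ‖x'‖ ^ 2 := by
        rw [inner_self_eq_norm_sq_to_K]; simp
      rw [← h3, e]
      refine (norm_add_le _ _).trans (add_le_add ?_ ?_)
      · exact (norm_inner_le_norm _ _).trans (by gcongr; exact hr _ hwx')
      · rw [norm_mul, Complex.norm_real, Real.norm_eq_abs]
        gcongr
        exact (norm_inner_le_norm _ _).trans (by gcongr; exact hc _)
    rcases (norm_nonneg x').eq_or_lt with h0 | h0
    · rw [← h0, mul_zero]; positivity
    · refine le_of_mul_le_mul_right ?_ h0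
      have h4 : (r + δ) * ‖x'‖ ^ 2 ≤ |μ| * ‖x'‖ ^ 2 := by
        gcongr
        rw [hμρ]
        linarith
      nlinarith
  have hx'b : ‖x'‖ ≤ |p| * (c / δ) * ‖x‖ := by
    rw [mul_comm, ← le_div_iff₀ hδ0] at hx'bound
    refine hx'bound.trans (le_of_eq ?_)
    ring
  have hvx : 1 / 2 * ‖x‖ ≤ ‖(inner ℂ (v p) x : ℂ)‖ := by
    have h1 : ‖x‖ ≤ ‖x'‖ + ‖a‖ := by
      calc ‖x‖ = ‖x' + a • w‖ := by rw [← hxdec]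
        _ ≤ ‖x'‖ + ‖a • w‖ := norm_add_le _ _
        _ = _ := by rw [norm_smul, hw, mul_one]
    have h2 : ‖a‖ ≤ ‖(inner ℂ (v p) x : ℂ)‖ + |p| * D * ‖x‖ := by
      have e : a = inner ℂ (v p) x - inner ℂ (v p - w) x := by rw [inner_sub_left]; ring
      rw [e]
      refine (norm_sub_le _ _).trans (add_le_add le_rfl ((norm_inner_le_norm _ _).trans ?_))
      gcongr
      exact hvw p hp1.le
    have h3 : |p| * (c / δ + D) * ‖x‖ ≤ 1 / 2 * ‖x‖ := by gcongr
    linarith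
  -- Symmetry gives `(μ - lam p) ⟨v p, x⟩ = p ^ 3 ⟨R p, x⟩`, and `hvx` keeps `⟨v p, x⟩` away from
  -- `0`.
  have hdiff : |μ - lam p| ≤ 2 * K * |p| ^ 3 := by
    have e : ((μ - lam p : ℝ) : ℂ) * inner ℂ (v p) x = (p : ℂ) ^ 3 * inner ℂ (R p) x := by
      have h1 := hA (v p) x
      rw [hres, hxe, inner_add_left, inner_smul_left, inner_smul_left, inner_smul_right] at h1
      simp only [map_pow, Complex.conj_ofReal] at h1
      push_cast
      linear_combination -h1
    have h2 := congrArg norm e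
    rw [norm_mul, norm_mul, norm_pow, Complex.norm_real, Complex.norm_real, Real.norm_eq_abs,
      Real.norm_eq_abs] at h2
    have h3 : ‖(inner ℂ (R p) x : ℂ)‖ ≤ K * ‖x‖ :=
      (norm_inner_le_norm _ _).trans (by gcongr; exact hRK p hp1.le)
    have h4 : |μ - lam p| * (1 / 2 * ‖x‖) ≤ |p| ^ 3 * (K * ‖x‖) := by
      calc _ ≤ |μ - lam p| * ‖(inner ℂ (v p) x : ℂ)‖ := by gcongr
        _ = _ := h2
        _ ≤ _ := by gcongr
    refine le_of_mul_le_mul_right ?_ hx0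
    linarith
  rw [abs_le]
  have hup : (spectralRadius ℂ (T + (p : ℂ) • M)).toReal ≤ lam p + 2 * K * |p| ^ 3 := by
    rw [← hμρ]
    have := abs_sub_abs_le_abs_sub μ (lam p)
    rw [abs_of_pos hlam0] at this
    linarith
  have hpos : 0 ≤ |p| ^ 3 * K := by positivity
  constructor <;> linarith

/-- The second-order coefficient of the spectral radius of `T + p M`, for an inner product given as
a core. -/
theorem isSecondOrderCoefficient_spectralRadius {F : Type*} [AddCommGroup F] [Module ℂ F]
    [FiniteDimensional ℂ F] (core : InnerProductSpace.Core ℂ F) {T M : Module.End ℂ F}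
    (hT : ∀ x y, core.inner (T x) y = core.inner x (T y))
    (hM : ∀ x y, core.inner (M x) y = core.inner x (M y)) {w y : F} {m₁ m₂ : ℝ}
    (hTw : T w = w) (hw : core.inner w w = 1)
    (hcon : ∀ x, core.inner w x = 0 → x ≠ 0 →
      (core.inner (T x) (T x)).re < (core.inner x x).re)
    (hwy : core.inner w y = 0) (hy : y - T y = M w - (m₁ : ℂ) • w)
    (hm₂ : core.inner w (M y) = (m₂ : ℂ)) :
    IsSecondOrderCoefficient (fun p : ℝ => (spectralRadius ℂ (T + (p : ℂ) • M)).toReal) m₂ := by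
  let : NormedAddCommGroup F := core.toNormedAddCommGroup
  let : InnerProductSpace ℂ F := InnerProductSpace.ofCore core.toCore
  have hsq : ∀ x : F, ‖x‖ ^ 2 = (core.inner x x).re := fun x =>
    (inner_self_eq_norm_sq (𝕜 := ℂ) x).symm
  obtain ⟨C, ε, hε, h⟩ := spectralRadius_sub_quadratic_isBigO (E := F) (T := T) (M := M)
    (w := w) (y := y) (m₁ := m₁) (m₂ := m₂) hT hM hTw
    (by have := hsq w; rw [hw, Complex.one_re] at this; nlinarith [norm_nonneg w])
    (fun x hx hx0 => by
      have := hcon x hx hx0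
      rw [← hsq, ← hsq] at this
      exact lt_of_pow_lt_pow_left₀ 2 (norm_nonneg _) this) hwy hy hm₂
  -- At `p = 0` the estimate is exact and identifies the constant term `1` with the value at `0`.
  have h0 := h 0 (by simpa using hε)
  simp only [abs_zero, ne_eq, OfNat.ofNat_ne_zero, not_false_eq_true, zero_pow, mul_zero,
    add_zero] at h0
  have h0' := sub_eq_zero.mp (abs_nonpos_iff.mp h0)
  refine ⟨m₁, ?_⟩
  simp only [h0']
  refine IsBigO.trans_isLittleO (g := fun p : ℝ => p ^ 3) ?_ ?_
  · refine IsBigO.of_bound C ?_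
    filter_upwards [nhdsWithin_le_nhds (Metric.ball_mem_nhds (0 : ℝ) hε)] with p hp
    rw [norm_pow, Real.norm_eq_abs, Real.norm_eq_abs]
    exact h p (by simpa using hp)
  · exact (isLittleO_pow_pow (by norm_num)).mono nhdsWithin_le_nhds

end Perturbation

open Matrix

/-! ### Laplacians, their Moore–Penrose inverses and information centrality. -/

namespace WeightedGraph

variable {V : Type*} [Fintype V] [DecidableEq V] (G : WeightedGraph V)

theorem laplacian_mulVec_apply (x : V → ℝ) (r : V) :
    (G.laplacian *ᵥ x) r = ∑ s, G.weight r s * (x r - x s) := by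
  have h : ∀ s, G.laplacian r s * x s =
      (if r = s then G.strength r * x r else 0) - G.weight r s * x s := by
    intro s
    by_cases h : r = s
    · subst h; simp [laplacian, G.weight_self]
    · simp [laplacian, h]
  simp only [mulVec, dotProduct, h, Finset.sum_sub_distrib, Finset.sum_ite_eq, Finset.mem_univ,
    if_true, mul_sub, strength, Finset.sum_mul]

theorem laplacian_mulVec_one : G.laplacian *ᵥ (fun _ => 1) = 0 := by
  ext r; simp [laplacian_mulVec_apply]

theorem laplacian_transpose : G.laplacianᵀ = G.laplacian := by
  simpa [conjTranspose_eq_transpose_of_trivial] using G.laplacian_isHermitian.eq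

theorem dotProduct_laplacian_mulVec (x : V → ℝ) :
    x ⬝ᵥ G.laplacian *ᵥ x = (∑ r, ∑ s, G.weight r s * (x r - x s) ^ 2) / 2 := by
  have h1 : x ⬝ᵥ G.laplacian *ᵥ x = ∑ r, ∑ s, G.weight r s * (x r * (x r - x s)) := by
    simp only [dotProduct, laplacian_mulVec_apply, Finset.mul_sum]
    exact Finset.sum_congr rfl fun r _ => Finset.sum_congr rfl fun s _ => by ring
  have h2 : x ⬝ᵥ G.laplacian *ᵥ x = ∑ r, ∑ s, G.weight r s * (x s * (x s - x r)) := by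
    rw [h1, Finset.sum_comm]
    exact Finset.sum_congr rfl fun r _ => Finset.sum_congr rfl fun s _ => by
      rw [G.weight_symm]
  rw [eq_div_iff two_ne_zero, mul_two]
  nth_rewrite 1 [h1]
  rw [h2, ← Finset.sum_add_distrib]
  refine Finset.sum_congr rfl fun r _ => ?_
  rw [← Finset.sum_add_distrib]
  exact Finset.sum_congr rfl fun s _ => by ring

/-- The signless counterpart of the Dirichlet form: for strengths below `1` both sums on the right
are nonnegative and the first is definite, so the spectrum of `L` stays strictly below `2`. -/
theorem two_mul_sub_dotProduct_laplacian_mulVec (x : V → ℝ) :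
    2 * (x ⬝ᵥ x) - x ⬝ᵥ G.laplacian *ᵥ x =
      ∑ r, 2 * (1 - G.strength r) * x r ^ 2 + (∑ r, ∑ s, G.weight r s * (x r + x s) ^ 2) / 2 := by
  have h3 : ∑ r, G.strength r * x r ^ 2 = ∑ r, ∑ s, G.weight r s * x r ^ 2 := by
    simp only [strength, Finset.sum_mul]
  have h4 : ∑ r, G.strength r * x r ^ 2 = ∑ r, ∑ s, G.weight r s * x s ^ 2 := by
    rw [h3, Finset.sum_comm]
    exact Finset.sum_congr rfl fun r _ => Finset.sum_congr rfl fun s _ => by rw [G.weight_symm]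
  have h5 : (∑ r, ∑ s, G.weight r s * (x r + x s) ^ 2) +
      ∑ r, ∑ s, G.weight r s * (x r - x s) ^ 2 =
      2 * ∑ r, ∑ s, G.weight r s * x r ^ 2 + 2 * ∑ r, ∑ s, G.weight r s * x s ^ 2 := by
    simp only [Finset.mul_sum, ← Finset.sum_add_distrib]
    exact Finset.sum_congr rfl fun r _ => Finset.sum_congr rfl fun s _ => by ring
  have h6 : ∑ r, 2 * (1 - G.strength r) * x r ^ 2 =
      2 * (x ⬝ᵥ x) - 2 * ∑ r, G.strength r * x r ^ 2 := by
    simp only [dotProduct, Finset.mul_sum, ← Finset.sum_sub_distrib]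
    exact Finset.sum_congr rfl fun r _ => by ring
  rw [dotProduct_laplacian_mulVec, h6]
  linarith

theorem dotProduct_laplacian_mulVec_nonneg (x : V → ℝ) : 0 ≤ x ⬝ᵥ G.laplacian *ᵥ x := by
  rw [dotProduct_laplacian_mulVec]
  exact div_nonneg (Finset.sum_nonneg fun r _ => Finset.sum_nonneg fun s _ =>
    mul_nonneg (G.weight_nonneg r s) (sq_nonneg _)) two_pos.le

theorem eq_of_dotProduct_laplacian_mulVec_eq_zero (hG : G.toSimpleGraph.Connected) {x : V → ℝ}
    (hx : x ⬝ᵥ G.laplacian *ᵥ x = 0) (r s : V) : x r = x s := by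
  have hnn : ∀ r s, 0 ≤ G.weight r s * (x r - x s) ^ 2 := fun r s =>
    mul_nonneg (G.weight_nonneg r s) (sq_nonneg _)
  rw [dotProduct_laplacian_mulVec, div_eq_zero_iff, or_iff_left two_ne_zero,
    Finset.sum_eq_zero_iff_of_nonneg fun r _ => Finset.sum_nonneg fun s _ => hnn r s] at hx
  have hadj : ∀ r s, G.toSimpleGraph.Adj r s → x r = x s := by
    intro r s (h : 0 < G.weight r s)
    have := (Finset.sum_eq_zero_iff_of_nonneg fun s _ => hnn r s).mp (hx r (Finset.mem_univ r)) s
      (Finset.mem_univ s)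
    rw [mul_eq_zero, or_iff_right h.ne', sq_eq_zero_iff, sub_eq_zero] at this
    exact this
  obtain ⟨p⟩ := hG.preconnected r s
  induction p with
  | nil => rfl
  | cons h _ ih => exact (hadj _ _ h).trans ih

theorem dotProduct_laplacian_mulVec_le (hG : ∀ r, G.strength r < 1) (x : V → ℝ) :
    x ⬝ᵥ G.laplacian *ᵥ x ≤ 2 * (x ⬝ᵥ x) ∧
      (x ⬝ᵥ G.laplacian *ᵥ x = 2 * (x ⬝ᵥ x) → x = 0) := by
  have h := G.two_mul_sub_dotProduct_laplacian_mulVec x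
  have h1 : 0 ≤ ∑ r, ∑ s, G.weight r s * (x r + x s) ^ 2 :=
    Finset.sum_nonneg fun r _ => Finset.sum_nonneg fun s _ =>
      mul_nonneg (G.weight_nonneg r s) (sq_nonneg _)
  have h2 : ∀ r ∈ Finset.univ, 0 ≤ 2 * (1 - G.strength r) * x r ^ 2 := fun r _ =>
    mul_nonneg (by linarith [hG r]) (sq_nonneg _)
  have h3 := Finset.sum_nonneg h2
  refine ⟨by linarith, fun he => ?_⟩
  have h4 : ∑ r, 2 * (1 - G.strength r) * x r ^ 2 = 0 := by linarith
  rw [Finset.sum_eq_zero_iff_of_nonneg h2] at h4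
  ext r
  have := h4 r (Finset.mem_univ r)
  rw [mul_eq_zero, or_iff_right (by linarith [hG r]), sq_eq_zero_iff] at this
  exact this

/-- As `L` is symmetric, the transpose also satisfies the Penrose conditions, which determine the
inverse. -/
theorem mpInverse_laplacian_transpose : (mpInverse G.laplacian)ᵀ = mpInverse G.laplacian := by
  have h := mpInverse_spec G.laplacian_isHermitian
  have hL := G.laplacian_transpose
  refine IsMoorePenroseInverse.unique (A := G.laplacian) ⟨?_, ?_, ?_, ?_⟩ h
  · have := congrArg transpose h.mul_mul_left
    simpa [transpose_mul, hL, Matrix.mul_assoc] using this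
  · have := congrArg transpose h.mul_mul_right
    simpa [transpose_mul, hL, Matrix.mul_assoc] using this
  · have := h.symm_right
    simp only [transpose_mul, hL, transpose_transpose] at this ⊢
    exact this.symm
  · have := h.symm_left
    simp only [transpose_mul, hL, transpose_transpose] at this ⊢
    exact this.symm

theorem mpInverse_laplacian_mulVec_one : mpInverse G.laplacian *ᵥ (fun _ => 1) = 0 := by
  have h := mpInverse_spec G.laplacian_isHermitian
  have h1 : (G.laplacian * mpInverse G.laplacian) *ᵥ (fun _ => 1) = 0 := by
    rw [← h.symm_left, transpose_mul, G.laplacian_transpose, ← mulVec_mulVec,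
      laplacian_mulVec_one, mulVec_zero]
  rw [← h.mul_mul_right, Matrix.mul_assoc, ← mulVec_mulVec, h1, mulVec_zero]

theorem mpInverse_laplacian_apply_self_nonneg (i : V) : 0 ≤ mpInverse G.laplacian i i := by
  have h := mpInverse_spec G.laplacian_isHermitian
  have h1 := G.dotProduct_laplacian_mulVec_nonneg (mpInverse G.laplacian *ᵥ Pi.single i 1)
  rw [mulVec_mulVec, dotProduct_comm, dotProduct_mulVec, ← mulVec_transpose,
    mpInverse_laplacian_transpose, mulVec_mulVec, ← Matrix.mul_assoc, h.mul_mul_right] at h1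
  simpa using h1

/-- The columns of `Q = 1 - L L†` lie in the kernel of `L`, hence are constant; by symmetry all
entries of `Q` agree, and `Q 1 = 1` fixes their value. -/
theorem laplacian_mul_mpInverse (hG : G.toSimpleGraph.Connected) :
    G.laplacian * mpInverse G.laplacian =
      1 - (1 / (Fintype.card V : ℝ)) • Matrix.of fun _ _ => (1 : ℝ) := by
  have h := mpInverse_spec G.laplacian_isHermitian
  set Q := 1 - G.laplacian * mpInverse G.laplacian with hQ
  have hQt : Qᵀ = Q := by rw [hQ, transpose_sub, h.symm_left, transpose_one]
  have hLQ : G.laplacian * Q = 0 := by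
    have h2 : Q * G.laplacian = 0 := by rw [hQ, sub_mul, h.mul_mul_left, one_mul, sub_self]
    have := congrArg transpose h2
    rwa [transpose_mul, hQt, G.laplacian_transpose, transpose_zero] at this
  have hconst : ∀ r s j, Q r j = Q s j := by
    intro r s j
    have := G.eq_of_dotProduct_laplacian_mulVec_eq_zero hG (x := Q *ᵥ Pi.single j 1)
      (by rw [mulVec_mulVec, hLQ, zero_mulVec, dotProduct_zero]) r s
    simpa using this
  have hall : ∀ r s j k, Q r j = Q s k := fun r s j k => by
    rw [hconst r k j, ← congrFun₂ hQt k j, transpose_apply, hconst j s k]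
  have hQ1 : Q *ᵥ (fun _ => 1) = fun _ => 1 := by
    rw [hQ, sub_mulVec, one_mulVec, ← mulVec_mulVec, mpInverse_laplacian_mulVec_one, mulVec_zero,
      sub_zero]
  have hval : ∀ r j, Q r j = 1 / (Fintype.card V : ℝ) := by
    intro r j
    have := congrFun hQ1 r
    simp only [mulVec, dotProduct, mul_one, hall r r _ j, Finset.sum_const, Finset.card_univ,
      nsmul_eq_mul] at this
    exact eq_one_div_of_mul_eq_one_right this
  have hQ' : Q = (1 / (Fintype.card V : ℝ)) • Matrix.of fun _ _ => (1 : ℝ) := by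
    ext r j; simp [hval]
  rw [← hQ', hQ]; abel

theorem inv_laplacian_add_ones (hG : G.toSimpleGraph.Connected) :
    (G.laplacian + Matrix.of fun _ _ => (1 : ℝ))⁻¹ =
      mpInverse G.laplacian + (1 / (Fintype.card V : ℝ) ^ 2) • Matrix.of fun _ _ => (1 : ℝ) := by
  have hn : (Fintype.card V : ℝ) ≠ 0 := by
    have := hG.nonempty
    exact_mod_cast Fintype.card_ne_zero
  refine inv_eq_right_inv ?_
  have e1 : G.laplacian * (Matrix.of fun _ _ => (1 : ℝ)) = 0 := by
    ext r s
    simpa [mul_apply, mulVec, dotProduct] using congrFun G.laplacian_mulVec_one r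
  have e2 : (Matrix.of fun _ _ => (1 : ℝ)) * mpInverse G.laplacian = 0 := by
    ext r s
    have := congrFun G.mpInverse_laplacian_mulVec_one s
    rw [← mpInverse_laplacian_transpose] at this
    simpa [mul_apply, mulVec, dotProduct] using this
  have e3 : (Matrix.of fun _ _ => (1 : ℝ) : Matrix V V ℝ) * (Matrix.of fun _ _ => (1 : ℝ)) =
      (Fintype.card V : ℝ) • Matrix.of fun _ _ => (1 : ℝ) := by
    ext r s; simp [mul_apply]
  rw [add_mul, mul_add, mul_add, laplacian_mul_mpInverse G hG, Matrix.mul_smul, e1, e2,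
    Matrix.mul_smul, e3, smul_zero, smul_smul]
  have e4 : 1 / (Fintype.card V : ℝ) ^ 2 * Fintype.card V = 1 / (Fintype.card V : ℝ) := by
    field_simp
  rw [e4]
  abel

/-- The multiple of the all-ones matrix cancels in `c_ii + c_jj - 2 c_ij`, and the rows of `L†` sum
to zero. -/
theorem informationCentrality_eq (hG : G.toSimpleGraph.Connected) (i : V) :
    G.informationCentrality i = (Fintype.card V : ℝ) /
      ((Fintype.card V : ℝ) * mpInverse G.laplacian i i + (mpInverse G.laplacian).trace) := by
  have hrow : ∑ j, mpInverse G.laplacian i j = 0 := by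
    simpa [mulVec, dotProduct] using congrFun G.mpInverse_laplacian_mulVec_one i
  rw [informationCentrality, inv_laplacian_add_ones G hG]
  congr 1
  simp only [Matrix.add_apply, Matrix.smul_apply, Matrix.of_apply, Finset.sum_sub_distrib,
    Finset.sum_add_distrib, ← Finset.mul_sum, hrow, trace, diag, Finset.sum_const,
    Finset.card_univ, nsmul_eq_mul]
  ring

theorem mpInverse_le_of_informationCentrality_le (hG : G.toSimpleGraph.Connected) {s t : V}
    (h : G.informationCentrality t ≤ G.informationCentrality s) :
    mpInverse G.laplacian s s ≤ mpInverse G.laplacian t t := by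
  have hn : 0 < (Fintype.card V : ℝ) := by
    have := hG.nonempty
    exact_mod_cast Fintype.card_pos
  have hd := G.mpInverse_laplacian_apply_self_nonneg
  have htr : ∀ i, mpInverse G.laplacian i i ≤ (mpInverse G.laplacian).trace := fun i =>
    Finset.single_le_sum (f := fun j => mpInverse G.laplacian j j) (fun j _ => hd j)
      (Finset.mem_univ i)
  rw [informationCentrality_eq G hG, informationCentrality_eq G hG] at h
  -- A zero denominator, where the quotient is `0` by convention, forces the trace and with it the
  -- whole diagonal of `L†` to vanish.
  rcases (add_nonneg (mul_nonneg hn.le (hd t)) ((hd t).trans (htr t))).eq_or_lt with h0 | h0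
  · have := htr s
    nlinarith [hd t, mul_nonneg hn.le (hd t)]
  rcases (add_nonneg (mul_nonneg hn.le (hd s)) ((hd s).trans (htr s))).eq_or_lt with h1 | h1
  · have := htr s
    nlinarith [hd t, hd s, mul_nonneg hn.le (hd s)]
  rw [div_le_div_iff_of_pos_left hn h0 h1] at h
  exact le_of_mul_le_mul_left (by linarith) hn

end WeightedGraph

/-! ### Contraction by `X ↦ K X K` and the Stein equation. -/

section RealMatrices

variable {V : Type*} [Fintype V]

theorem trace_transpose_mul_self (X : Matrix V V ℝ) :
    (Xᵀ * X).trace = ∑ j, (fun i => X i j) ⬝ᵥ fun i => X i j := by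
  simp [trace, mul_apply, dotProduct]

theorem trace_transpose_mul_self_nonneg (X : Matrix V V ℝ) : 0 ≤ (Xᵀ * X).trace := by
  rw [trace_transpose_mul_self]
  exact Finset.sum_nonneg fun j _ => Finset.sum_nonneg fun i _ => mul_self_nonneg _

theorem trace_transpose_mul_comm (X Y : Matrix V V ℝ) : (Xᵀ * Y).trace = (Yᵀ * X).trace := by
  rw [← trace_transpose, transpose_mul, transpose_transpose]

theorem trace_transpose_vecMulVec_mul (a b : V → ℝ) (X : Matrix V V ℝ) :
    ((vecMulVec a b)ᵀ * X).trace = a ⬝ᵥ X *ᵥ b := by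
  rw [transpose_vecMulVec, vecMulVec_mul, trace_vecMulVec, dotProduct_comm, dotProduct_mulVec]

theorem vecMul_of_symm {K : Matrix V V ℝ} (hK : Kᵀ = K) (x : V → ℝ) : x ᵥ* K = K *ᵥ x := by
  rw [← vecMul_transpose, hK]

/-- `K` is symmetric, fixes the unit vector `u`, does not increase the norm, and strictly decreases
the norm of every vector that is not a multiple of `u`. -/
structure IsLeadingVector (K : Matrix V V ℝ) (u : V → ℝ) : Prop where
  symm : Kᵀ = K
  norm_eq_one : u ⬝ᵥ u = 1
  mulVec_eq : K *ᵥ u = u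
  le : ∀ x, (K *ᵥ x) ⬝ᵥ (K *ᵥ x) ≤ x ⬝ᵥ x
  eq_smul : ∀ x, (K *ᵥ x) ⬝ᵥ (K *ᵥ x) = x ⬝ᵥ x → x = (u ⬝ᵥ x) • u

namespace IsLeadingVector

variable {K : Matrix V V ℝ} {u : V → ℝ} (h : IsLeadingVector K u)

include h

/-- The squared Frobenius norm is the sum over the columns, so equality forces equality in each
column. -/
theorem trace_mul_left_le (X : Matrix V V ℝ) :
    ((K * X)ᵀ * (K * X)).trace ≤ (Xᵀ * X).trace ∧
      (((K * X)ᵀ * (K * X)).trace = (Xᵀ * X).trace → X = vecMulVec u (u ᵥ* X)) := by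
  rw [trace_transpose_mul_self, trace_transpose_mul_self]
  have hle : ∀ j ∈ Finset.univ, ((fun i => (K * X) i j) ⬝ᵥ fun i => (K * X) i j) ≤
      (fun i => X i j) ⬝ᵥ fun i => X i j := fun j _ => h.le fun i => X i j
  refine ⟨Finset.sum_le_sum hle, fun he => ?_⟩
  ext i j
  have := h.eq_smul _ ((Finset.sum_eq_sum_iff_of_le hle).mp he j (Finset.mem_univ j))
  rw [congrFun this i, vecMulVec_apply, Pi.smul_apply, smul_eq_mul, mul_comm]
  rfl

theorem trace_mul_right_le (X : Matrix V V ℝ) :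
    ((X * K)ᵀ * (X * K)).trace ≤ (Xᵀ * X).trace ∧
      (((X * K)ᵀ * (X * K)).trace = (Xᵀ * X).trace → X = vecMulVec (X *ᵥ u) u) := by
  have h1 := h.trace_mul_left_le Xᵀ
  have e1 : ((K * Xᵀ)ᵀ * (K * Xᵀ)).trace = ((X * K)ᵀ * (X * K)).trace := by
    rw [trace_mul_comm, transpose_mul, transpose_mul, transpose_transpose, h.symm]
  have e2 : (Xᵀᵀ * Xᵀ).trace = (Xᵀ * X).trace := by rw [transpose_transpose, trace_mul_comm]
  rw [e1, e2] at h1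
  refine ⟨h1.1, fun he => ?_⟩
  have := congrArg transpose (h1.2 he)
  rwa [transpose_transpose, transpose_vecMulVec, vecMul_transpose] at this

theorem trace_mul_mul_le (X : Matrix V V ℝ) :
    ((K * X * K)ᵀ * (K * X * K)).trace ≤ (Xᵀ * X).trace := by
  rw [Matrix.mul_assoc]
  exact (h.trace_mul_left_le _).1.trans (h.trace_mul_right_le X).1

/-- Equality must hold for both the right and the left multiplication, which makes `X` a multiple of
`u uᵀ`; `hu` says that the multiple is zero. -/
theorem eq_zero_of_trace_eq {X : Matrix V V ℝ} (hu : u ⬝ᵥ X *ᵥ u = 0)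
    (he : ((K * X * K)ᵀ * (K * X * K)).trace = (Xᵀ * X).trace) : X = 0 := by
  rw [Matrix.mul_assoc] at he
  have h1 := h.trace_mul_left_le (X * K)
  have h2 := h.trace_mul_right_le X
  have e1 := h2.2 (le_antisymm h2.1 (he ▸ h1.1))
  have e2 : X * K = X := by
    rw [e1, vecMulVec_mul, vecMul_of_symm h.symm, h.mulVec_eq]
  rw [e2] at h1
  have e3 := h1.2 (le_antisymm h1.1 (by rw [he.symm, e2]))
  have e4 : X *ᵥ u = 0 := by
    have : X *ᵥ u = (u ⬝ᵥ X *ᵥ u) • u := by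
      conv_lhs => rw [e3]
      ext i
      rw [dotProduct_mulVec]
      simp [mulVec, vecMulVec_apply, dotProduct, mul_comm, mul_left_comm,
        Finset.mul_sum]
    rw [this, hu, zero_smul]
  rw [e1, e4]
  simp

/-- The equation `Y - K Y K = c cᵀ` for `c` orthogonal to the leading vector. -/
theorem exists_stein_solution {c : V → ℝ} (hc : u ⬝ᵥ c = 0) :
    ∃ Y : Matrix V V ℝ, u ⬝ᵥ Y *ᵥ u = 0 ∧ Y - K * Y * K = vecMulVec c c := by
  have hKu : ∀ Y : Matrix V V ℝ, u ⬝ᵥ (Y - K * Y * K) *ᵥ u = 0 := fun Y => by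
    rw [sub_mulVec, ← mulVec_mulVec, h.mulVec_eq, ← mulVec_mulVec, dotProduct_sub,
      dotProduct_mulVec u K, vecMul_of_symm h.symm, h.mulVec_eq, sub_self]
  have hw : u ⬝ᵥ vecMulVec u u *ᵥ u = 1 := by
    rw [vecMulVec_mulVec, h.norm_eq_one]; simp [h.norm_eq_one]
  -- The added rank-one term removes the kernel of `Y ↦ Y - K Y K`; injectivity then gives
  -- surjectivity in finite dimension.
  let F : Matrix V V ℝ →ₗ[ℝ] Matrix V V ℝ :=
    { toFun := fun Y => Y - K * Y * K + (u ⬝ᵥ Y *ᵥ u) • vecMulVec u u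
      map_add' := fun X Y => by
        simp only [Matrix.mul_add, Matrix.add_mul, add_mulVec, dotProduct_add, add_smul]; abel
      map_smul' := fun a X => by
        simp only [Matrix.mul_smul, Matrix.smul_mul, smul_mulVec, dotProduct_smul, smul_add,
          smul_sub, RingHom.id_apply, smul_eq_mul, mul_smul] }
  have hpair : ∀ Y, u ⬝ᵥ F Y *ᵥ u = u ⬝ᵥ Y *ᵥ u := fun Y => by
    change u ⬝ᵥ (Y - K * Y * K + (u ⬝ᵥ Y *ᵥ u) • vecMulVec u u) *ᵥ u = _
    rw [add_mulVec, dotProduct_add, hKu, smul_mulVec, dotProduct_smul, hw, zero_add,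
      smul_eq_mul, mul_one]
  have hF : ∀ Y, u ⬝ᵥ Y *ᵥ u = 0 → F Y = Y - K * Y * K := fun Y hY => by
    change Y - K * Y * K + (u ⬝ᵥ Y *ᵥ u) • vecMulVec u u = _
    rw [hY, zero_smul, add_zero]
  have hinj : Function.Injective F := by
    refine (injective_iff_map_eq_zero F).mpr fun Y hY => ?_
    have h0 : u ⬝ᵥ Y *ᵥ u = 0 := by rw [← hpair, hY]; simp
    rw [hF Y h0, sub_eq_zero] at hY
    exact h.eq_zero_of_trace_eq h0 (by rw [← hY])
  obtain ⟨Y, hY⟩ := LinearMap.injective_iff_surjective.mp hinj (vecMulVec c c)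
  have h0 : u ⬝ᵥ Y *ᵥ u = 0 := by
    rw [← hpair, hY, vecMulVec_mulVec]; simp [hc]
  exact ⟨Y, h0, (hF Y h0).symm.trans hY⟩

/-- In Frobenius terms the quantity is `⟨Y - T Y, Y⟩`, and `2 ⟨Y - T Y, Y⟩ = ‖Y - T Y‖² + ‖Y‖² - ‖T
Y‖²` with `T` a contraction. -/
theorem stein_solution_nonneg {c : V → ℝ} {Y : Matrix V V ℝ}
    (hY : Y - K * Y * K = vecMulVec c c) : 0 ≤ c ⬝ᵥ Y *ᵥ c := by
  have h1 := trace_transpose_mul_self_nonneg (Y - K * Y * K)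
  have h2 := h.trace_mul_mul_le Y
  rw [← trace_transpose_vecMulVec_mul, ← hY]
  simp only [transpose_sub, Matrix.sub_mul, Matrix.mul_sub, trace_sub] at h1 ⊢
  have h3 := trace_transpose_mul_comm (K * Y * K) Y
  linarith

end IsLeadingVector

theorem trace_transpose_mul_mul_nonneg {K : Matrix V V ℝ} (hK : ∀ x, 0 ≤ x ⬝ᵥ K *ᵥ x)
    (X : Matrix V V ℝ) : 0 ≤ (Xᵀ * (K * X)).trace := by
  have : (Xᵀ * (K * X)).trace = ∑ j, (fun i => X i j) ⬝ᵥ K *ᵥ fun i => X i j := by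
    simp [trace, mul_apply, dotProduct, mulVec]
  rw [this]
  exact Finset.sum_nonneg fun j _ => hK _

open scoped MatrixOrder Matrix.Norms.L2Operator in
-- Factoring `A = Rᵀ R` reduces this to the form of `K` on the columns of `X Rᵀ`.
theorem trace_transpose_mul_mul_mul_nonneg [DecidableEq V] {K A : Matrix V V ℝ}
    (hK : ∀ x, 0 ≤ x ⬝ᵥ K *ᵥ x) (hAs : Aᵀ = A) (hA : ∀ x, 0 ≤ x ⬝ᵥ A *ᵥ x) (X : Matrix V V ℝ) :
    0 ≤ (Xᵀ * (K * X * A)).trace := by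
  have hpsd : A.PosSemidef :=
    PosSemidef.of_dotProduct_mulVec_nonneg
      (by rwa [IsHermitian, conjTranspose_eq_transpose_of_trivial]) (by simpa using hA)
  obtain ⟨R, hR⟩ := CStarAlgebra.nonneg_iff_eq_star_mul_self.mp hpsd.nonneg
  rw [star_eq_conjTranspose, conjTranspose_eq_transpose_of_trivial] at hR
  have := trace_transpose_mul_mul_nonneg hK (X * Rᵀ)
  rw [transpose_mul, transpose_transpose, Matrix.mul_assoc, trace_mul_comm] at this
  rw [hR]
  simpa only [Matrix.mul_assoc] using this

/-- With `A = 1 - K`, the Stein equation reads `A Y + K Y A = c cᵀ`. Positivity of `K` and `A` gives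
`⟨Y, A Y⟩ ≤ cᵀ Y c`. As `A (d cᵀ) = c cᵀ`, the form of `A` at `Y - d cᵀ` gives `2 cᵀ Y c ≤ ⟨Y, A Y⟩
+ (c ⬝ᵥ d) (c ⬝ᵥ c)`. -/
theorem IsLeadingVector.stein_solution_le [DecidableEq V] {K : Matrix V V ℝ} {u : V → ℝ}
    (h : IsLeadingVector K u) (hK : ∀ x, 0 ≤ x ⬝ᵥ K *ᵥ x) {c d : V → ℝ} (hd : d - K *ᵥ d = c)
    {Y : Matrix V V ℝ} (hY : Y - K * Y * K = vecMulVec c c) :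
    c ⬝ᵥ Y *ᵥ c ≤ (c ⬝ᵥ d) * (c ⬝ᵥ c) := by
  set A := 1 - K with hA
  have hAs : Aᵀ = A := by rw [hA, transpose_sub, transpose_one, h.symm]
  have hApos : ∀ x, 0 ≤ x ⬝ᵥ A *ᵥ x := fun x => by
    have h1 : 0 ≤ (x - K *ᵥ x) ⬝ᵥ (x - K *ᵥ x) :=
      Finset.sum_nonneg fun i _ => mul_self_nonneg _
    have h2 := h.le x
    rw [dotProduct_sub, sub_dotProduct, sub_dotProduct, dotProduct_comm (K *ᵥ x) x] at h1
    rw [hA, sub_mulVec, one_mulVec, dotProduct_sub]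
    linarith
  have h1 := trace_transpose_mul_mul_mul_nonneg hK hAs hApos Y
  have h2 := trace_transpose_mul_mul_nonneg hApos (Y - vecMulVec d c)
  have hAD : A * vecMulVec d c = vecMulVec c c := by
    rw [mul_vecMulVec, hA, sub_mulVec, one_mulVec, hd]
  have e1 : (Yᵀ * vecMulVec c c).trace = c ⬝ᵥ Y *ᵥ c := by
    rw [trace_transpose_mul_comm, trace_transpose_vecMulVec_mul]
  have e2 : ((vecMulVec d c)ᵀ * (A * Y)).trace = c ⬝ᵥ Y *ᵥ c := by
    rw [← trace_transpose_vecMulVec_mul, ← hAD, transpose_mul, hAs, Matrix.mul_assoc]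
  have e3 : ((vecMulVec d c)ᵀ * vecMulVec c c).trace = (c ⬝ᵥ d) * (c ⬝ᵥ c) := by
    rw [trace_transpose_vecMulVec_mul, vecMulVec_mulVec, dotProduct_comm c d]
    simp [mul_comm]
  have e4 : K * Y * A = vecMulVec c c - A * Y := by
    rw [← hY, hA]; noncomm_ring
  rw [e4, Matrix.mul_sub, trace_sub, e1] at h1
  rw [Matrix.mul_sub, hAD, transpose_sub, Matrix.sub_mul, Matrix.mul_sub, Matrix.mul_sub, trace_sub,
    trace_sub, trace_sub, e1, e2, e3] at h2
  linarith

end RealMatrices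

/-! ### The perturbation theorem applied to complex matrices with the Frobenius inner product. -/

section ComplexMatrices

variable {V : Type*} [Fintype V]

/-- The entrywise embedding of real matrices into complex matrices. -/
abbrev complexify (X : Matrix V V ℝ) : Matrix V V ℂ := X.map Complex.ofReal

theorem complexify_mul (X Y : Matrix V V ℝ) :
    complexify (X * Y) = complexify X * complexify Y :=
  Matrix.map_mul (f := Complex.ofRealHom)

omit [Fintype V] in
theorem conjTranspose_complexify (X : Matrix V V ℝ) : (complexify X)ᴴ = complexify Xᵀ := by
  ext i j; simp

theorem trace_complexify (X : Matrix V V ℝ) : (complexify X).trace = (X.trace : ℂ) := by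
  simp [trace]

omit [Fintype V] in
theorem complexify_re_add_im (X : Matrix V V ℂ) :
    complexify (X.map Complex.re) + Complex.I • complexify (X.map Complex.im) = X := by
  ext i j
  simp [mul_comm Complex.I, Complex.re_add_im]

open scoped ComplexOrder in
/-- The Frobenius inner product on complex matrices. -/
abbrev frobeniusCore (V : Type*) [Fintype V] : InnerProductSpace.Core ℂ (Matrix V V ℂ) where
  inner X Y := (Xᴴ * Y).trace
  conj_inner_symm X Y := by
    rw [starRingEnd_apply, ← trace_conjTranspose, conjTranspose_mul, conjTranspose_conjTranspose]
  re_inner_nonneg X := (Complex.nonneg_iff.mp (posSemidef_conjTranspose_mul_self X).trace_nonneg).1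
  add_left X Y Z := by simp [conjTranspose_add, Matrix.add_mul]
  smul_left X Y r := by simp
  definite X hX := trace_conjTranspose_mul_self_eq_zero_iff.mp hX

/-- The operator `X ↦ A X B` on complex matrices, for real `A` and `B`. -/
def sandwich (A B : Matrix V V ℝ) : Module.End ℂ (Matrix V V ℂ) where
  toFun X := complexify A * X * complexify B
  map_add' X Y := by simp only [Matrix.mul_add, Matrix.add_mul]
  map_smul' c X := by simp only [Matrix.mul_smul, Matrix.smul_mul, RingHom.id_apply]

theorem sandwich_apply (A B : Matrix V V ℝ) (X : Matrix V V ℂ) :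
    sandwich A B X = complexify A * X * complexify B := rfl

theorem sandwich_complexify (A B X : Matrix V V ℝ) :
    sandwich A B (complexify X) = complexify (A * X * B) := by
  rw [sandwich_apply, complexify_mul, complexify_mul]

theorem inner_sandwich (A B : Matrix V V ℝ) (X Y : Matrix V V ℂ) :
    ((sandwich A B X)ᴴ * Y).trace = (Xᴴ * sandwich Aᵀ Bᵀ Y).trace := by
  rw [sandwich_apply, sandwich_apply, conjTranspose_mul, conjTranspose_mul,
    conjTranspose_complexify, conjTranspose_complexify, Matrix.mul_assoc, trace_mul_comm]
  simp only [Matrix.mul_assoc]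

theorem inner_complexify (X Y : Matrix V V ℝ) :
    ((complexify X)ᴴ * complexify Y).trace = ((Xᵀ * Y).trace : ℂ) := by
  rw [conjTranspose_complexify, ← complexify_mul, trace_complexify]

theorem re_inner_add_I_smul (X Y : Matrix V V ℝ) :
    (((complexify X + Complex.I • complexify Y)ᴴ *
      (complexify X + Complex.I • complexify Y)).trace).re =
      (Xᵀ * X).trace + (Yᵀ * Y).trace := by
  simp only [conjTranspose_add, conjTranspose_smul, Matrix.add_mul, Matrix.mul_add,
    Matrix.smul_mul, Matrix.mul_smul, trace_add, trace_smul, inner_complexify]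
  simp

/-- For real `K` the real and imaginary parts of `X` decouple and their squared norms add. -/
theorem IsLeadingVector.inner_sandwich_lt {K : Matrix V V ℝ} {u : V → ℝ}
    (h : IsLeadingVector K u) {X : Matrix V V ℂ}
    (hX : ((complexify (vecMulVec u u))ᴴ * X).trace = 0) (hX0 : X ≠ 0) :
    (((sandwich K K X)ᴴ * sandwich K K X).trace).re < ((Xᴴ * X).trace).re := by
  obtain ⟨X₁, X₂, rfl⟩ : ∃ X₁ X₂ : Matrix V V ℝ, X = complexify X₁ + Complex.I • complexify X₂ :=
    ⟨_, _, (complexify_re_add_im X).symm⟩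
  rw [Matrix.mul_add, Matrix.mul_smul, trace_add, trace_smul, inner_complexify, inner_complexify,
    trace_transpose_vecMulVec_mul, trace_transpose_vecMulVec_mul] at hX
  have h1 : u ⬝ᵥ X₁ *ᵥ u = 0 := by simpa using congrArg Complex.re hX
  have h2 : u ⬝ᵥ X₂ *ᵥ u = 0 := by simpa using congrArg Complex.im hX
  rw [map_add, map_smul, sandwich_complexify, sandwich_complexify, re_inner_add_I_smul,
    re_inner_add_I_smul]
  have l1 := h.trace_mul_mul_le X₁
  have l2 := h.trace_mul_mul_le X₂
  by_contra hlt
  have z1 := h.eq_zero_of_trace_eq h1 (by linarith)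
  have z2 := h.eq_zero_of_trace_eq h2 (by linarith)
  refine hX0 ?_
  rw [z1, z2]
  ext i j; simp

/-- The second moment operator with rank one noise is an affine function of the probability. -/
theorem secondMomentOperator_eq [DecidableEq V] (K B : Matrix V V ℝ) (p : ℝ) :
    secondMomentOperator (K - p • B) B (p * (1 - p)) =
      sandwich K K + (p : ℂ) • (sandwich B B - sandwich B K - sandwich K B) := by
  refine LinearMap.ext fun X => ?_
  have e : (K - p • B).map Complex.ofReal = complexify K - (p : ℂ) • complexify B := by
    ext i j; simp
  simp only [secondMomentOperator, LinearMap.coe_mk, AddHom.coe_mk, e, LinearMap.add_apply,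
    LinearMap.smul_apply, LinearMap.sub_apply, sandwich_apply, Matrix.sub_mul, Matrix.mul_sub,
    Matrix.smul_mul, Matrix.mul_smul]
  push_cast
  module

/-- The second-order coefficient for an edge matrix `β b bᵀ`, where `b = θ u + c` and
`c = d - K d` is orthogonal to the leading vector `u`. -/
theorem IsLeadingVector.exists_secondOrderCoefficient [DecidableEq V] {K : Matrix V V ℝ}
    {u : V → ℝ} (h : IsLeadingVector K u) (β θ : ℝ) {b c d : V → ℝ} (hb : b = θ • u + c)
    (hud : u ⬝ᵥ d = 0) (hd : d - K *ᵥ d = c) :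
    ∃ C : ℝ, IsSecondOrderCoefficient (fun p : ℝ => (spectralRadius ℂ (secondMomentOperator
        (K - p • (β • vecMulVec b b)) (β • vecMulVec b b) (p * (1 - p)))).toReal) C ∧
      2 * (1 - β * θ ^ 2) ^ 2 * β ^ 2 * (c ⬝ᵥ d) * θ ^ 2 ≤ C ∧
      ((∀ x, 0 ≤ x ⬝ᵥ K *ᵥ x) → C ≤ 2 * (1 - β * θ ^ 2) ^ 2 * β ^ 2 * (c ⬝ᵥ d) * θ ^ 2 +
        β ^ 4 * (c ⬝ᵥ d) * (c ⬝ᵥ c) * θ ^ 4) := by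
  have hKv : ∀ x, u ⬝ᵥ K *ᵥ x = u ⬝ᵥ x := fun x => by
    rw [dotProduct_mulVec, vecMul_of_symm h.symm, h.mulVec_eq]
  have huc : u ⬝ᵥ c = 0 := by rw [← hd, dotProduct_sub, hKv, sub_self]
  have hcu : c ⬝ᵥ u = 0 := by rw [dotProduct_comm, huc]
  have hdu : d ⬝ᵥ u = 0 := by rw [dotProduct_comm, hud]
  have huu := h.norm_eq_one
  have hbu : b ⬝ᵥ u = θ := by rw [hb, add_dotProduct, smul_dotProduct, huu, hcu]; simp
  have hKd : K *ᵥ d = d - c := by rw [← hd]; abel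
  obtain ⟨Y, hYu, hY⟩ := h.exists_stein_solution huc
  -- Testing the Stein equation on `d` from the right and `u` from the left turns `d - K d` into
  -- `c`, so symmetry of `Y` is not needed.
  have hYc : u ⬝ᵥ Y *ᵥ c = 0 := by
    have h1 : u ⬝ᵥ (Y - K * Y * K) *ᵥ d = 0 := by
      rw [hY, vecMulVec_mulVec]; simp [huc]
    rw [sub_mulVec, dotProduct_sub, ← mulVec_mulVec, ← mulVec_mulVec, hKv, hKd, mulVec_sub,
      dotProduct_sub] at h1
    linarith
  have hcY : c ⬝ᵥ Y *ᵥ u = 0 := by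
    have h1 : d ⬝ᵥ (Y - K * Y * K) *ᵥ u = 0 := by
      rw [hY, vecMulVec_mulVec, hcu]; simp
    rw [sub_mulVec, dotProduct_sub, ← mulVec_mulVec, ← mulVec_mulVec, h.mulVec_eq,
      dotProduct_mulVec d K, vecMul_of_symm h.symm, hKd, sub_dotProduct] at h1
    linarith
  set B := β • vecMulVec b b with hB
  have hBt : Bᵀ = B := by rw [hB, transpose_smul, transpose_vecMulVec]
  set α := β ^ 2 * θ ^ 3 - β * θ with hα
  set γ := β ^ 2 * θ ^ 2 with hγ
  -- The first-order corrector: `d` inverts the mixed terms `u cᵀ + c uᵀ` of `M w`, and `Y` inverts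
  -- `c cᵀ` (see `hMw`).
  set y := α • (vecMulVec u d + vecMulVec d u) + γ • Y with hy
  set m₁ := β ^ 2 * θ ^ 4 - 2 * β * θ ^ 2 with hm₁
  set m₂ := 2 * α ^ 2 * (c ⬝ᵥ d) + γ ^ 2 * (c ⬝ᵥ Y *ᵥ c) with hm₂
  have hBu : B *ᵥ u = (β * θ) • b := by
    rw [hB, smul_mulVec, vecMulVec_mulVec, hbu, op_smul_eq_smul, smul_smul]
  have huB : u ᵥ* B = (β * θ) • b := by rw [vecMul_of_symm hBt, hBu]
  have huK : u ᵥ* K = u := by rw [vecMul_of_symm h.symm, h.mulVec_eq]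
  have hdK : d ᵥ* K = d - c := by rw [vecMul_of_symm h.symm, hKd]
  have hMw : B * vecMulVec u u * B - B * vecMulVec u u * K - K * vecMulVec u u * B =
      m₁ • vecMulVec u u + α • (vecMulVec u c + vecMulVec c u) + γ • vecMulVec c c := by
    simp only [mul_vecMulVec, vecMulVec_mul, hBu, huB, huK, h.mulVec_eq, hb]
    ext i j
    simp only [vecMulVec_apply, Matrix.sub_apply, Matrix.add_apply, Matrix.smul_apply,
      Pi.add_apply, Pi.smul_apply, smul_eq_mul, hm₁, hα, hγ]
    ring
  have hyeq : y - K * y * K = α • (vecMulVec u c + vecMulVec c u) + γ • vecMulVec c c := by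
    have e : y - K * y * K = α • (vecMulVec u d + vecMulVec d u -
        K * (vecMulVec u d + vecMulVec d u) * K) + γ • (Y - K * Y * K) := by
      simp only [hy, Matrix.mul_add, Matrix.add_mul, Matrix.mul_smul, Matrix.smul_mul, smul_sub,
        smul_add]
      abel
    rw [e, hY]
    simp only [Matrix.mul_add, Matrix.add_mul, mul_vecMulVec, vecMulVec_mul, huK, hdK, hKd,
      h.mulVec_eq]
    ext i j
    simp only [vecMulVec_apply, Matrix.sub_apply, Matrix.add_apply, Matrix.smul_apply,
      Pi.sub_apply, smul_eq_mul]
    ring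
  have hform : ∀ a e, a ⬝ᵥ y *ᵥ e =
      α * ((a ⬝ᵥ u) * (d ⬝ᵥ e) + (a ⬝ᵥ d) * (u ⬝ᵥ e)) + γ * (a ⬝ᵥ Y *ᵥ e) := fun a e => by
    simp only [hy, add_mulVec, smul_mulVec, vecMulVec_mulVec, dotProduct_add, dotProduct_smul,
      smul_eq_mul, op_smul_eq_smul, smul_add]
    ring
  have hyuu : u ⬝ᵥ y *ᵥ u = 0 := by rw [hform, hdu, hud, hYu]; ring
  have hyuc : u ⬝ᵥ y *ᵥ c = α * (c ⬝ᵥ d) := by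
    rw [hform, huu, huc, hYc, dotProduct_comm d c]; ring
  have hycu : c ⬝ᵥ y *ᵥ u = α * (c ⬝ᵥ d) := by rw [hform, huu, hcu, hcY]; ring
  have hycc : c ⬝ᵥ y *ᵥ c = γ * (c ⬝ᵥ Y *ᵥ c) := by rw [hform, huc, hcu]; ring
  have hMy : u ⬝ᵥ (B * y * B - B * y * K - K * y * B) *ᵥ u = m₂ := by
    have e1 : u ⬝ᵥ (B * y * B - B * y * K - K * y * B) *ᵥ u =
        (β * θ) ^ 2 * (b ⬝ᵥ y *ᵥ b) - β * θ * (b ⬝ᵥ y *ᵥ u) - β * θ * (u ⬝ᵥ y *ᵥ b) := by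
      simp only [sub_mulVec, dotProduct_sub, ← mulVec_mulVec, hBu, h.mulVec_eq, hKv,
        dotProduct_mulVec u B, huB, smul_dotProduct, mulVec_smul, dotProduct_smul, smul_eq_mul]
      ring
    rw [e1, hb]
    simp only [mulVec_add, mulVec_smul, dotProduct_add, add_dotProduct, dotProduct_smul,
      smul_dotProduct, hyuu, hyuc, hycu, hycc, smul_eq_mul, hm₂, hα, hγ]
    ring
  refine ⟨m₂, ?_, ?_, ?_⟩
  · simp only [secondMomentOperator_eq]
    refine isSecondOrderCoefficient_spectralRadius (frobeniusCore V) (m₁ := m₁)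
      (w := complexify (vecMulVec u u)) (y := complexify y) ?_ ?_ ?_ ?_ ?_ ?_ ?_ ?_
    · intro X Z
      exact (inner_sandwich K K X Z).trans (by rw [h.symm]; rfl)
    · intro X Z
      change ((_ : Matrix V V ℂ)ᴴ * _).trace = ((_ : Matrix V V ℂ)ᴴ * _).trace
      simp only [LinearMap.sub_apply, conjTranspose_sub, Matrix.sub_mul, Matrix.mul_sub,
        trace_sub, inner_sandwich, h.symm, hBt]
    · rw [sandwich_complexify, mul_vecMulVec, vecMulVec_mul, huK, h.mulVec_eq]
    · change ((_ : Matrix V V ℂ)ᴴ * _).trace = 1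
      rw [inner_complexify, trace_transpose_vecMulVec_mul, vecMulVec_mulVec, huu]
      simp [huu]
    · exact fun X hX hX0 => h.inner_sandwich_lt hX hX0
    · change ((_ : Matrix V V ℂ)ᴴ * _).trace = 0
      rw [inner_complexify, trace_transpose_vecMulVec_mul, hyuu, Complex.ofReal_zero]
    · have e : y - K * y * K = B * vecMulVec u u * B - B * vecMulVec u u * K -
          K * vecMulVec u u * B - m₁ • vecMulVec u u := by
        rw [hyeq, hMw]; abel
      simp only [LinearMap.sub_apply, sandwich_complexify]
      have e' := congrArg complexify e
      ext i j
      have := congrFun₂ e' i j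
      simpa using this
    · change ((_ : Matrix V V ℂ)ᴴ * _).trace = (m₂ : ℂ)
      have e : (sandwich B B - sandwich B K - sandwich K B) (complexify y) =
          complexify (B * y * B - B * y * K - K * y * B) := by
        simp only [LinearMap.sub_apply, sandwich_complexify]
        ext i j; simp
      rw [e, inner_complexify, trace_transpose_vecMulVec_mul, hMy]
  · have := mul_nonneg (sq_nonneg γ) (h.stein_solution_nonneg hY)
    have e : 2 * (1 - β * θ ^ 2) ^ 2 * β ^ 2 * (c ⬝ᵥ d) * θ ^ 2 = 2 * α ^ 2 * (c ⬝ᵥ d) := by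
      rw [hα]; ring
    rw [hm₂, e]
    linarith
  · intro hK
    have := mul_le_mul_of_nonneg_left (h.stein_solution_le hK hd hY) (sq_nonneg γ)
    have e : 2 * (1 - β * θ ^ 2) ^ 2 * β ^ 2 * (c ⬝ᵥ d) * θ ^ 2 = 2 * α ^ 2 * (c ⬝ᵥ d) := by
      rw [hα]; ring
    have e' : β ^ 4 * (c ⬝ᵥ d) * (c ⬝ᵥ c) * θ ^ 4 = γ ^ 2 * ((c ⬝ᵥ d) * (c ⬝ᵥ c)) := by
      rw [hγ]; ring
    rw [hm₂, e, e']
    linarith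

end ComplexMatrices

/-! ### Spectral estimates for a single Laplacian. -/

namespace WeightedGraph

variable {V : Type*} [Fintype V] [DecidableEq V] (G : WeightedGraph V)

theorem dotProduct_laplacian_mulVec_comm (x y : V → ℝ) :
    x ⬝ᵥ G.laplacian *ᵥ y = (G.laplacian *ᵥ x) ⬝ᵥ y := by
  rw [dotProduct_mulVec, vecMul_of_symm G.laplacian_transpose]

theorem sum_laplacian_mulVec (x : V → ℝ) : ∑ r, (G.laplacian *ᵥ x) r = 0 := by
  have := G.dotProduct_laplacian_mulVec_comm (fun _ => 1) x
  rw [laplacian_mulVec_one, zero_dotProduct] at this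
  simpa [dotProduct] using this

/-- This is `L² ≤ 2 L`, that is, `‖x - L x‖ ≤ ‖x‖`. It follows from nonnegativity of the form of `L`
at `2 x - L x` and its bound by `2` at `L x`. -/
theorem laplacian_mulVec_dotProduct_self_le (hG : ∀ r, G.strength r < 1) (x : V → ℝ) :
    (G.laplacian *ᵥ x) ⬝ᵥ (G.laplacian *ᵥ x) ≤ 2 * (x ⬝ᵥ G.laplacian *ᵥ x) ∧
      ((G.laplacian *ᵥ x) ⬝ᵥ (G.laplacian *ᵥ x) = 2 * (x ⬝ᵥ G.laplacian *ᵥ x) →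
        G.laplacian *ᵥ x = 0) := by
  have h1 := G.dotProduct_laplacian_mulVec_le hG (G.laplacian *ᵥ x)
  have h2 := G.dotProduct_laplacian_mulVec_nonneg ((2 : ℝ) • x - G.laplacian *ᵥ x)
  have h3 := G.dotProduct_laplacian_mulVec_comm x (G.laplacian *ᵥ x)
  simp only [mulVec_sub, mulVec_smul, dotProduct_sub, sub_dotProduct, dotProduct_smul,
    smul_dotProduct, smul_eq_mul, h3] at h2
  exact ⟨by linarith [h1.1], fun he => h1.2 (by linarith [h1.1])⟩

theorem sum_mpInverse_mulVec_single (s : V) :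
    ∑ i, (mpInverse G.laplacian *ᵥ Pi.single s 1) i = 0 := by
  have := congrFun G.mpInverse_laplacian_mulVec_one s
  rw [← G.mpInverse_laplacian_transpose] at this
  simp only [mulVec_single_one]
  simpa [mulVec, dotProduct] using this

theorem laplacian_mulVec_mpInverse_mulVec_single (hG : G.toSimpleGraph.Connected) (s : V) :
    G.laplacian *ᵥ (mpInverse G.laplacian *ᵥ Pi.single s 1) =
      Pi.single s 1 - fun _ => 1 / (Fintype.card V : ℝ) := by
  rw [mulVec_mulVec, G.laplacian_mul_mpInverse hG, sub_mulVec, one_mulVec, smul_mulVec]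
  ext i
  simp

theorem dotProduct_laplacian_mulVec_le_of_eigenvalue_le
    (hG : ∀ μ : ℝ, Module.End.HasEigenvalue (Matrix.toLin' G.laplacian) μ → μ ≤ 1) (x : V → ℝ) :
    x ⬝ᵥ G.laplacian *ᵥ x ≤ x ⬝ᵥ x := by
  have hH : (1 - G.laplacian).IsHermitian := isHermitian_one.sub G.laplacian_isHermitian
  have hpsd : (1 - G.laplacian).PosSemidef := by
    refine hH.posSemidef_iff_eigenvalues_nonneg.mpr fun i => ?_
    have hv := hH.mulVec_eigenvectorBasis i
    rw [sub_mulVec, one_mulVec] at hv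
    have hne : (hH.eigenvectorBasis i : V → ℝ) ≠ 0 := by
      intro h0
      exact hH.eigenvectorBasis.orthonormal.ne_zero i (by ext j; exact congrFun h0 j)
    have := hG (1 - hH.eigenvalues i) (Module.End.hasEigenvalue_of_hasEigenvector
      (x := (hH.eigenvectorBasis i : V → ℝ)) (Module.End.hasEigenvector_iff.mpr
        ⟨Module.End.mem_eigenspace_iff.mpr (by
          rw [toLin'_apply, sub_smul, one_smul, ← hv]; abel), hne⟩))
    simpa using this
  have := hpsd.dotProduct_mulVec_nonneg x
  rw [sub_mulVec, one_mulVec, dotProduct_sub] at this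
  simpa using this

end WeightedGraph

/-! ### The projection onto vectors of zero sum. -/

section Projection

variable {V : Type*} [Fintype V] [DecidableEq V]

theorem projection_mulVec_apply (x : V → ℝ) (i : V) :
    (projection V *ᵥ x) i = x i - (∑ j, x j) / Fintype.card V := by
  rw [projection, sub_mulVec, one_mulVec, smul_mulVec]
  simp [mulVec, dotProduct, div_eq_inv_mul]

theorem projection_mulVec_of_sum_eq_zero {x : V → ℝ} (hx : ∑ j, x j = 0) :
    projection V *ᵥ x = x := by
  ext i; rw [projection_mulVec_apply, hx]; simp

theorem projection_transpose : (projection V)ᵀ = projection V := by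
  ext i j; simp [projection, Matrix.one_apply, eq_comm]

theorem sum_projection_mulVec [Nonempty V] (x : V → ℝ) : ∑ i, (projection V *ᵥ x) i = 0 := by
  have : (Fintype.card V : ℝ) ≠ 0 := by exact_mod_cast Fintype.card_ne_zero
  simp only [projection_mulVec_apply, Finset.sum_sub_distrib, Finset.sum_const, Finset.card_univ,
    nsmul_eq_mul]
  field_simp
  ring

theorem projection_mulVec_dotProduct_self [Nonempty V] (x : V → ℝ) :
    x ⬝ᵥ x = (projection V *ᵥ x) ⬝ᵥ (projection V *ᵥ x) + (∑ j, x j) ^ 2 / Fintype.card V := by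
  have h1 : (projection V *ᵥ x) ⬝ᵥ (projection V *ᵥ x) = x ⬝ᵥ (projection V *ᵥ x) := by
    rw [dotProduct_mulVec, vecMul_of_symm projection_transpose,
      projection_mulVec_of_sum_eq_zero (sum_projection_mulVec x), dotProduct_comm]
  rw [h1]
  simp only [dotProduct, projection_mulVec_apply, mul_sub, Finset.sum_sub_distrib,
    ← Finset.sum_mul]
  ring

end Projection

/-! ### The two joined subgraphs: leading vector, edge vector and bounds. -/

section TwoSubgraphs

variable {V₁ V₂ : Type*} [Fintype V₁] [Fintype V₂] [DecidableEq V₁] [DecidableEq V₂]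

/-- The values of the leading vector on the two subgraphs. -/
theorem exists_theta (N₁ N₂ : ℕ) (h₁ : 0 < N₁) (h₂ : 0 < N₂) :
    ∃ θ₁ θ₂ : ℝ, thetaDiff N₁ N₂ * θ₁ = 1 / N₁ ∧ thetaDiff N₁ N₂ * θ₂ = -(1 / N₂) ∧
      thetaDiff N₁ N₂ ^ 2 = 1 / N₁ + 1 / N₂ ∧ N₁ * θ₁ + N₂ * θ₂ = 0 ∧
      N₁ * θ₁ ^ 2 + N₂ * θ₂ ^ 2 = 1 := by
  have p₁ : (0 : ℝ) < N₁ := by exact_mod_cast h₁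
  have p₂ : (0 : ℝ) < N₂ := by exact_mod_cast h₂
  set a := √((N₂ : ℝ) / (((N₁ : ℝ) + N₂) * N₁)) with ha
  set b := √((N₁ : ℝ) / (((N₁ : ℝ) + N₂) * N₂)) with hb
  have ha2 : a * a = (N₂ : ℝ) / (((N₁ : ℝ) + N₂) * N₁) := Real.mul_self_sqrt (by positivity)
  have hb2 : b * b = (N₁ : ℝ) / (((N₁ : ℝ) + N₂) * N₂) := Real.mul_self_sqrt (by positivity)
  have hab : a * b = 1 / ((N₁ : ℝ) + N₂) := by
    rw [ha, hb, ← Real.sqrt_mul (by positivity), Real.sqrt_eq_iff_mul_self_eq (by positivity)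
      (by positivity)]
    field_simp
  have hθ : thetaDiff N₁ N₂ = a + b := by simp only [thetaDiff, ← ha, ← hb]; ring
  have e1 : (a + b) * a = 1 / N₁ := by
    rw [add_mul, ha2, mul_comm b a, hab]; field_simp; ring
  have e2 : (a + b) * b = 1 / N₂ := by
    rw [add_mul, hb2, hab]; field_simp; ring
  have hpos : a + b ≠ 0 := by
    intro h0
    rw [h0, zero_mul] at e1
    exact (one_div_pos.mpr p₁).ne e1
  refine ⟨a, -b, by rw [hθ, e1], by rw [hθ, ← e2]; ring, ?_, ?_, ?_⟩
  · rw [hθ, ← e1, ← e2]; ring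
  · refine mul_left_cancel₀ hpos ?_
    calc (a + b) * (N₁ * a + N₂ * -b) = N₁ * ((a + b) * a) - N₂ * ((a + b) * b) := by ring
      _ = _ := by rw [e1, e2]; field_simp; ring
  · calc N₁ * a ^ 2 + N₂ * (-b) ^ 2 = N₁ * (a * a) + N₂ * (b * b) := by ring
      _ = _ := by rw [ha2, hb2]; field_simp; ring

/-- The unperturbed matrix `P (I - L_sub) P`. -/
def baseMatrix (G₁ : WeightedGraph V₁) (G₂ : WeightedGraph V₂) :
    Matrix (V₁ ⊕ V₂) (V₁ ⊕ V₂) ℝ :=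
  projection (V₁ ⊕ V₂) * (1 - subLaplacian G₁ G₂) * projection (V₁ ⊕ V₂)

variable (G₁ : WeightedGraph V₁) (G₂ : WeightedGraph V₂)

theorem subLaplacian_mulVec (x : V₁ ⊕ V₂ → ℝ) : subLaplacian G₁ G₂ *ᵥ x =
    Sum.elim (G₁.laplacian *ᵥ (x ∘ Sum.inl)) (G₂.laplacian *ᵥ (x ∘ Sum.inr)) := by
  rw [subLaplacian, fromBlocks_mulVec]; simp

theorem sum_subLaplacian_mulVec (x : V₁ ⊕ V₂ → ℝ) : ∑ i, (subLaplacian G₁ G₂ *ᵥ x) i = 0 := by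
  rw [subLaplacian_mulVec, Fintype.sum_sum_type]
  simp [WeightedGraph.sum_laplacian_mulVec]

theorem baseMatrix_transpose : (baseMatrix G₁ G₂)ᵀ = baseMatrix G₁ G₂ := by
  have : (subLaplacian G₁ G₂)ᵀ = subLaplacian G₁ G₂ := by
    rw [subLaplacian, fromBlocks_transpose, G₁.laplacian_transpose, G₂.laplacian_transpose]; simp
  simp only [baseMatrix, transpose_mul, projection_transpose, transpose_sub, transpose_one, this,
    Matrix.mul_assoc]

theorem baseMatrix_mulVec [Nonempty V₁] (x : V₁ ⊕ V₂ → ℝ) :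
    baseMatrix G₁ G₂ *ᵥ x = projection (V₁ ⊕ V₂) *ᵥ x -
      subLaplacian G₁ G₂ *ᵥ (projection (V₁ ⊕ V₂) *ᵥ x) := by
  rw [baseMatrix, ← mulVec_mulVec, ← mulVec_mulVec, sub_mulVec, one_mulVec]
  refine projection_mulVec_of_sum_eq_zero ?_
  simp only [Pi.sub_apply, Finset.sum_sub_distrib, sum_projection_mulVec, sum_subLaplacian_mulVec,
    sub_zero]

omit [DecidableEq V₁] [DecidableEq V₂] in
theorem dotProduct_sum_type (x y : V₁ ⊕ V₂ → ℝ) :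
    x ⬝ᵥ y = (x ∘ Sum.inl) ⬝ᵥ (y ∘ Sum.inl) + (x ∘ Sum.inr) ⬝ᵥ (y ∘ Sum.inr) := by
  simp [dotProduct, Fintype.sum_sum_type]

theorem baseMatrix_isLeadingVector (hconn₁ : G₁.toSimpleGraph.Connected)
    (hconn₂ : G₂.toSimpleGraph.Connected) (hstrength₁ : ∀ r, G₁.strength r < 1)
    (hstrength₂ : ∀ r, G₂.strength r < 1) {θ₁ θ₂ : ℝ}
    (h0 : Fintype.card V₁ * θ₁ + Fintype.card V₂ * θ₂ = 0)
    (h1 : Fintype.card V₁ * θ₁ ^ 2 + Fintype.card V₂ * θ₂ ^ 2 = 1) :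
    IsLeadingVector (baseMatrix G₁ G₂) (Sum.elim (fun _ => θ₁) fun _ => θ₂) := by
  have := hconn₁.nonempty
  have := hconn₂.nonempty
  have p₁ : (0 : ℝ) < Fintype.card V₁ := by exact_mod_cast Fintype.card_pos
  have p₂ : (0 : ℝ) < Fintype.card V₂ := by exact_mod_cast Fintype.card_pos
  -- The loss of squared norm under `K` splits into three nonnegative parts: the mean and one defect
  -- `2 L - L²` per subgraph.
  have key : ∀ x : V₁ ⊕ V₂ → ℝ, ∀ z, z = projection (V₁ ⊕ V₂) *ᵥ x →
      x ⬝ᵥ x - (baseMatrix G₁ G₂ *ᵥ x) ⬝ᵥ (baseMatrix G₁ G₂ *ᵥ x) =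
      (∑ j, x j) ^ 2 / Fintype.card (V₁ ⊕ V₂) +
      (2 * ((z ∘ Sum.inl) ⬝ᵥ G₁.laplacian *ᵥ (z ∘ Sum.inl)) -
        (G₁.laplacian *ᵥ (z ∘ Sum.inl)) ⬝ᵥ (G₁.laplacian *ᵥ (z ∘ Sum.inl))) +
      (2 * ((z ∘ Sum.inr) ⬝ᵥ G₂.laplacian *ᵥ (z ∘ Sum.inr)) -
        (G₂.laplacian *ᵥ (z ∘ Sum.inr)) ⬝ᵥ (G₂.laplacian *ᵥ (z ∘ Sum.inr))) := by
    rintro x z hz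
    rw [projection_mulVec_dotProduct_self, baseMatrix_mulVec, ← hz, dotProduct_sub,
      sub_dotProduct, sub_dotProduct, dotProduct_comm (subLaplacian G₁ G₂ *ᵥ z) z,
      dotProduct_sum_type z (subLaplacian G₁ G₂ *ᵥ z),
      dotProduct_sum_type (subLaplacian G₁ G₂ *ᵥ z) (subLaplacian G₁ G₂ *ᵥ z),
      subLaplacian_mulVec]
    simp only [Sum.elim_comp_inl, Sum.elim_comp_inr]
    ring
  refine ⟨baseMatrix_transpose G₁ G₂, ?_, ?_, fun x => ?_, fun x he => ?_⟩
  · rw [dotProduct_sum_type, ← h1]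
    simp [dotProduct, sq]
  · have hs : ∑ j, (Sum.elim (fun _ => θ₁) fun _ => θ₂ : V₁ ⊕ V₂ → ℝ) j = 0 := by
      rw [Fintype.sum_sum_type]; simpa using h0
    rw [baseMatrix_mulVec, projection_mulVec_of_sum_eq_zero hs, subLaplacian_mulVec]
    ext i
    cases i <;> simp [WeightedGraph.laplacian_mulVec_apply]
  · have hk := key x _ rfl
    have l1 := (G₁.laplacian_mulVec_dotProduct_self_le hstrength₁
      ((projection (V₁ ⊕ V₂) *ᵥ x) ∘ Sum.inl)).1
    have l2 := (G₂.laplacian_mulVec_dotProduct_self_le hstrength₂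
      ((projection (V₁ ⊕ V₂) *ᵥ x) ∘ Sum.inr)).1
    have l3 : 0 ≤ (∑ j, x j) ^ 2 / (Fintype.card (V₁ ⊕ V₂) : ℝ) := by positivity
    linarith
  · have hk := key x _ rfl
    have l1 := G₁.laplacian_mulVec_dotProduct_self_le hstrength₁
      ((projection (V₁ ⊕ V₂) *ᵥ x) ∘ Sum.inl)
    have l2 := G₂.laplacian_mulVec_dotProduct_self_le hstrength₂
      ((projection (V₁ ⊕ V₂) *ᵥ x) ∘ Sum.inr)
    have l3 : 0 ≤ (∑ j, x j) ^ 2 / (Fintype.card (V₁ ⊕ V₂) : ℝ) := by positivity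
    have hs : ∑ j, x j = 0 := by
      have : (∑ j, x j) ^ 2 / (Fintype.card (V₁ ⊕ V₂) : ℝ) = 0 := by
        linarith [l1.1, l2.1]
      have hN : (Fintype.card (V₁ ⊕ V₂) : ℝ) ≠ 0 := by exact_mod_cast Fintype.card_ne_zero
      rw [div_eq_zero_iff, or_iff_left hN, sq_eq_zero_iff] at this
      exact this
    rw [projection_mulVec_of_sum_eq_zero hs] at hk l1 l2
    have z1 := l1.2 (by linarith [l1.1, l2.1])
    have z2 := l2.2 (by linarith [l1.1, l2.1])
    have c1 := G₁.eq_of_dotProduct_laplacian_mulVec_eq_zero hconn₁ (x := x ∘ Sum.inl)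
      (by rw [z1, dotProduct_zero])
    have c2 := G₂.eq_of_dotProduct_laplacian_mulVec_eq_zero hconn₂ (x := x ∘ Sum.inr)
      (by rw [z2, dotProduct_zero])
    obtain ⟨i₁⟩ := hconn₁.nonempty
    obtain ⟨i₂⟩ := hconn₂.nonempty
    obtain ⟨a₁, a₂, rfl⟩ : ∃ a₁ a₂, x = Sum.elim (fun _ => a₁) fun _ => a₂ := by
      refine ⟨x (Sum.inl i₁), x (Sum.inr i₂), ?_⟩
      ext i
      cases i with
      | inl i => exact c1 i i₁
      | inr i => exact c2 i i₂
    rw [Fintype.sum_sum_type] at hs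
    simp only [Sum.elim_inl, Sum.elim_inr, Finset.sum_const, Finset.card_univ, nsmul_eq_mul] at hs
    have hdot : (Sum.elim (fun _ => θ₁) fun _ => θ₂ : V₁ ⊕ V₂ → ℝ) ⬝ᵥ
        (Sum.elim (fun _ => a₁) fun _ => a₂) =
        Fintype.card V₁ * (θ₁ * a₁) + Fintype.card V₂ * (θ₂ * a₂) := by
      simp [dotProduct, Fintype.sum_sum_type]
    -- Both pairs of values are orthogonal to `(N₁, N₂)` in the plane, hence proportional.
    have hcross : θ₁ * a₂ = θ₂ * a₁ := by
      refine mul_left_cancel₀ p₁.ne' (mul_left_cancel₀ p₂.ne' ?_)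
      linear_combination (Fintype.card V₂ * a₂ : ℝ) * h0 - (Fintype.card V₂ * θ₂ : ℝ) * hs
    rw [hdot]
    ext i
    cases i with
    | inl i =>
      simp only [Sum.elim_inl, Pi.smul_apply, smul_eq_mul]
      linear_combination -a₁ * h1 - (Fintype.card V₂ * θ₂ : ℝ) * hcross
    | inr i =>
      simp only [Sum.elim_inr, Pi.smul_apply, smul_eq_mul]
      linear_combination -a₂ * h1 + (Fintype.card V₁ * θ₁ : ℝ) * hcross

theorem baseMatrix_nonneg [Nonempty V₁]
    (hG₁ : ∀ μ : ℝ, Module.End.HasEigenvalue (Matrix.toLin' G₁.laplacian) μ → μ ≤ 1)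
    (hG₂ : ∀ μ : ℝ, Module.End.HasEigenvalue (Matrix.toLin' G₂.laplacian) μ → μ ≤ 1)
    (x : V₁ ⊕ V₂ → ℝ) : 0 ≤ x ⬝ᵥ baseMatrix G₁ G₂ *ᵥ x := by
  set z := projection (V₁ ⊕ V₂) *ᵥ x with hz
  have e : x ⬝ᵥ baseMatrix G₁ G₂ *ᵥ x = z ⬝ᵥ z - z ⬝ᵥ subLaplacian G₁ G₂ *ᵥ z := by
    rw [baseMatrix, ← mulVec_mulVec, ← mulVec_mulVec, dotProduct_mulVec,
      vecMul_of_symm projection_transpose, ← hz, sub_mulVec, one_mulVec, dotProduct_sub]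
  have l1 := G₁.dotProduct_laplacian_mulVec_le_of_eigenvalue_le hG₁ (z ∘ Sum.inl)
  have l2 := G₂.dotProduct_laplacian_mulVec_le_of_eigenvalue_le hG₂ (z ∘ Sum.inr)
  rw [e, dotProduct_sum_type z, dotProduct_sum_type z, subLaplacian_mulVec, Sum.elim_comp_inl,
    Sum.elim_comp_inr]
  linarith

/-- The vector of the connecting edge. -/
def edgeVector (s₁ : V₁) (s₂ : V₂) : V₁ ⊕ V₂ → ℝ :=
  Sum.elim (Pi.single s₁ 1) (-Pi.single s₂ 1)

/-- The edge vector has zero sum, so `P B P = B` and the projections act only on the base matrix. -/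
theorem meanSquareOperator_eq (β : ℝ) (s₁ : V₁) (s₂ : V₂) (p : ℝ) :
    meanSquareOperator G₁ G₂ β s₁ s₂ p = secondMomentOperator (baseMatrix G₁ G₂ -
      p • (β • vecMulVec (edgeVector s₁ s₂) (edgeVector s₁ s₂)))
      (β • vecMulVec (edgeVector s₁ s₂) (edgeVector s₁ s₂)) (p * (1 - p)) := by
  have hP : projection (V₁ ⊕ V₂) *ᵥ edgeVector s₁ s₂ = edgeVector s₁ s₂ :=
    projection_mulVec_of_sum_eq_zero (by simp [edgeVector, Fintype.sum_sum_type])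
  have hB : edgeMatrix β s₁ s₂ = β • vecMulVec (edgeVector s₁ s₂) (edgeVector s₁ s₂) := rfl
  rw [meanSquareOperator, hB, expectedWeightMatrix, hB, Matrix.mul_sub, Matrix.sub_mul]
  simp only [Matrix.mul_smul, Matrix.smul_mul, mul_vecMulVec, vecMulVec_mul, hP,
    vecMul_of_symm projection_transpose, baseMatrix]

theorem exists_secondOrderCoefficient_meanSquareRate (hconn₁ : G₁.toSimpleGraph.Connected)
    (hconn₂ : G₂.toSimpleGraph.Connected) (hstrength₁ : ∀ r, G₁.strength r < 1)
    (hstrength₂ : ∀ r, G₂.strength r < 1) (β : ℝ) (s₁ : V₁) (s₂ : V₂) :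
    ∃ C : ℝ, IsSecondOrderCoefficient (meanSquareRate G₁ G₂ β s₁ s₂) C ∧
      lowerBound G₁ G₂ β s₁ s₂ ≤ C ∧
      ((∀ μ : ℝ, Module.End.HasEigenvalue (Matrix.toLin' G₁.laplacian) μ → μ ≤ 1) →
        (∀ μ : ℝ, Module.End.HasEigenvalue (Matrix.toLin' G₂.laplacian) μ → μ ≤ 1) →
        C ≤ upperBound G₁ G₂ β s₁ s₂) := by
  have := hconn₁.nonempty
  have := hconn₂.nonempty
  obtain ⟨θ₁, θ₂, ht1, ht2, ht, h0, h1⟩ :=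
    exists_theta (Fintype.card V₁) (Fintype.card V₂) Fintype.card_pos Fintype.card_pos
  set θ := thetaDiff (Fintype.card V₁) (Fintype.card V₂) with hθ
  have hlead := baseMatrix_isLeadingVector G₁ G₂ hconn₁ hconn₂ hstrength₁ hstrength₂ h0 h1
  set u : V₁ ⊕ V₂ → ℝ := Sum.elim (fun _ => θ₁) fun _ => θ₂ with hu
  set b := edgeVector s₁ s₂ with hb
  set c := b - θ • u with hc
  -- On each subgraph `c` is, up to sign, an indicator minus its mean, which `L_k L_k†` produces.
  -- The two parts of `d` have zero sum, so `d - K d = L_sub d`.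
  set d : V₁ ⊕ V₂ → ℝ := Sum.elim (mpInverse G₁.laplacian *ᵥ Pi.single s₁ 1)
    (-(mpInverse G₂.laplacian *ᵥ Pi.single s₂ 1)) with hd
  have hsd₁ := G₁.sum_mpInverse_mulVec_single s₁
  have hsd₂ := G₂.sum_mpInverse_mulVec_single s₂
  have hsumd : ∑ i, d i = 0 := by
    rw [hd, Fintype.sum_sum_type]
    simp only [Sum.elim_inl, Sum.elim_inr, Pi.neg_apply, Finset.sum_neg_distrib, hsd₁, hsd₂]
    simp
  have hud : u ⬝ᵥ d = 0 := by
    rw [hu, hd, dotProduct, Fintype.sum_sum_type]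
    simp only [Sum.elim_inl, Sum.elim_inr, Pi.neg_apply, ← Finset.mul_sum,
      Finset.sum_neg_distrib, hsd₁, hsd₂]
    simp
  have hLd : d - baseMatrix G₁ G₂ *ᵥ d = c := by
    rw [baseMatrix_mulVec, projection_mulVec_of_sum_eq_zero hsumd, sub_sub_cancel,
      subLaplacian_mulVec, hd, Sum.elim_comp_inl, Sum.elim_comp_inr, mulVec_neg,
      G₁.laplacian_mulVec_mpInverse_mulVec_single hconn₁,
      G₂.laplacian_mulVec_mpInverse_mulVec_single hconn₂, hc, hb, hu]
    ext i
    cases i with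
    | inl i => simp [edgeVector, ht1]
    | inr i => simp [edgeVector, ht2]; ring
  have hbd : b ⬝ᵥ d = bridgeSum G₁ G₂ s₁ s₂ := by
    rw [dotProduct_sum_type, hb, hd]
    simp [edgeVector, bridgeSum]
  have hbu : u ⬝ᵥ b = θ := by
    rw [dotProduct_sum_type, hb, hu]
    have hθ0 : θ ≠ 0 := by
      intro h
      rw [h, zero_mul] at ht1
      have : (0 : ℝ) < 1 / Fintype.card V₁ := by
        have : (0 : ℝ) < Fintype.card V₁ := by exact_mod_cast Fintype.card_pos
        positivity
      exact this.ne ht1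
    have : θ₁ - θ₂ = θ := by
      refine mul_left_cancel₀ hθ0 ?_
      rw [mul_sub, ht1, ht2, ← sq, ht]; ring
    rw [← this]
    simp [edgeVector, sub_eq_add_neg]
  have hbb : b ⬝ᵥ b = 2 := by
    rw [dotProduct_sum_type, hb]
    simp [edgeVector]; norm_num
  have hcd : c ⬝ᵥ d = bridgeSum G₁ G₂ s₁ s₂ := by
    rw [hc, sub_dotProduct, smul_dotProduct, hud, hbd]; simp
  -- Pythagoras: `‖c‖² = ‖b‖² - θ²`, with `θ² = 1 / N₁ + 1 / N₂`.
  have hcc : c ⬝ᵥ c = 2 - 1 / (Fintype.card V₁ : ℝ) - 1 / (Fintype.card V₂ : ℝ) := by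
    rw [hc]
    simp only [dotProduct_sub, sub_dotProduct, dotProduct_smul, smul_dotProduct, smul_eq_mul,
      dotProduct_comm b u, hbu, hbb, hlead.norm_eq_one]
    linear_combination -ht
  obtain ⟨C, hC, hlow, hup⟩ := hlead.exists_secondOrderCoefficient β θ (b := b) (c := c) (d := d)
    (by rw [hc]; abel) hud hLd
  refine ⟨C, ?_, ?_, fun hG₁ hG₂ => ?_⟩
  · have e : meanSquareRate G₁ G₂ β s₁ s₂ = fun p : ℝ => (spectralRadius ℂ (secondMomentOperator
        (baseMatrix G₁ G₂ - p • (β • vecMulVec b b)) (β • vecMulVec b b) (p * (1 - p)))).toReal := by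
      funext p
      rw [meanSquareRate, meanSquareOperator_eq]
    rwa [e]
  · rwa [hcd] at hlow
  · have := hup (baseMatrix_nonneg G₁ G₂ hG₁ hG₂)
    rwa [hcd, hcc] at this

theorem lowerBound_mono_of_bridgeSum_le (β : ℝ) {s₁ t₁ : V₁} {s₂ t₂ : V₂}
    (h : bridgeSum G₁ G₂ s₁ s₂ ≤ bridgeSum G₁ G₂ t₁ t₂) :
    lowerBound G₁ G₂ β s₁ s₂ ≤ lowerBound G₁ G₂ β t₁ t₂ := by
  simp only [lowerBound]
  gcongr

theorem upperBound_mono_of_bridgeSum_le [Nonempty V₁] [Nonempty V₂] (β : ℝ) {s₁ t₁ : V₁}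
    {s₂ t₂ : V₂} (h : bridgeSum G₁ G₂ s₁ s₂ ≤ bridgeSum G₁ G₂ t₁ t₂) :
    upperBound G₁ G₂ β s₁ s₂ ≤ upperBound G₁ G₂ β t₁ t₂ := by
  have h₁ : 1 / (Fintype.card V₁ : ℝ) ≤ 1 :=
    div_le_one_of_le₀ (by exact_mod_cast Fintype.card_pos) (by positivity)
  have h₂ : 1 / (Fintype.card V₂ : ℝ) ≤ 1 :=
    div_le_one_of_le₀ (by exact_mod_cast Fintype.card_pos) (by positivity)
  have h₃ : 0 ≤ 2 - 1 / (Fintype.card V₁ : ℝ) - 1 / (Fintype.card V₂ : ℝ) := by linarith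
  refine add_le_add (lowerBound_mono_of_bridgeSum_le G₁ G₂ β h) ?_
  gcongr

end TwoSubgraphs

end NetworkOfNetworks

end

theorem mainTheorem11 {V₁ V₂ : Type*} [Fintype V₁] [Fintype V₂] [DecidableEq V₁] [DecidableEq V₂]
    (G₁ : NetworkOfNetworks.WeightedGraph V₁) (G₂ : NetworkOfNetworks.WeightedGraph V₂)
    (hconn₁ : G₁.toSimpleGraph.Connected) (hconn₂ : G₂.toSimpleGraph.Connected)
    (hstrength₁ : ∀ r, G₁.strength r < 1) (hstrength₂ : ∀ r, G₂.strength r < 1)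
    (β : ℝ) (s₁ : V₁) (s₂ : V₂) :
    (∃ C : ℝ,
      NetworkOfNetworks.IsSecondOrderCoefficient
        (NetworkOfNetworks.meanSquareRate G₁ G₂ β s₁ s₂) C ∧
      NetworkOfNetworks.lowerBound G₁ G₂ β s₁ s₂ ≤ C ∧
      ((∀ μ : ℝ, Module.End.HasEigenvalue (Matrix.toLin' G₁.laplacian) μ → μ ≤ 1) →
        (∀ μ : ℝ, Module.End.HasEigenvalue (Matrix.toLin' G₂.laplacian) μ → μ ≤ 1) →
        C ≤ NetworkOfNetworks.upperBound G₁ G₂ β s₁ s₂)) ∧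
    ((∀ t, G₁.informationCentrality t ≤ G₁.informationCentrality s₁) →
      ∀ t, NetworkOfNetworks.mpInverse G₁.laplacian s₁ s₁ ≤
        NetworkOfNetworks.mpInverse G₁.laplacian t t) ∧
    ((∀ t, G₂.informationCentrality t ≤ G₂.informationCentrality s₂) →
      ∀ t, NetworkOfNetworks.mpInverse G₂.laplacian s₂ s₂ ≤
        NetworkOfNetworks.mpInverse G₂.laplacian t t) ∧
    ((∀ t, G₁.informationCentrality t ≤ G₁.informationCentrality s₁) →
      (∀ t, G₂.informationCentrality t ≤ G₂.informationCentrality s₂) →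
      ∀ (t₁ : V₁) (t₂ : V₂),
        NetworkOfNetworks.lowerBound G₁ G₂ β s₁ s₂ ≤
            NetworkOfNetworks.lowerBound G₁ G₂ β t₁ t₂ ∧
          NetworkOfNetworks.upperBound G₁ G₂ β s₁ s₂ ≤
            NetworkOfNetworks.upperBound G₁ G₂ β t₁ t₂) := by
  have := hconn₁.nonempty
  have := hconn₂.nonempty
  refine ⟨NetworkOfNetworks.exists_secondOrderCoefficient_meanSquareRate G₁ G₂ hconn₁ hconn₂
    hstrength₁ hstrength₂ β s₁ s₂,
    fun h t => G₁.mpInverse_le_of_informationCentrality_le hconn₁ (h t),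
    fun h t => G₂.mpInverse_le_of_informationCentrality_le hconn₂ (h t), fun h₁ h₂ t₁ t₂ => ?_⟩
  have hle : NetworkOfNetworks.bridgeSum G₁ G₂ s₁ s₂ ≤
      NetworkOfNetworks.bridgeSum G₁ G₂ t₁ t₂ :=
    add_le_add (G₁.mpInverse_le_of_informationCentrality_le hconn₁ (h₁ t₁))
      (G₂.mpInverse_le_of_informationCentrality_le hconn₂ (h₂ t₂))
  exact ⟨NetworkOfNetworks.lowerBound_mono_of_bridgeSum_le G₁ G₂ β hle,
    NetworkOfNetworks.upperBound_mono_of_bridgeSum_le G₁ G₂ β hle⟩
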